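/- Let $\varepsilon>0$ and $\mathrm{OPT}>0$ be real numbers. Let $B$ be an axis-parallel box of positive width and of height $h(B)\ge(2/3+2\varepsilon)\mathrm{OPT}$, whose left and right borders have integer $x$-coordinates. Let $T$ be a finite set of pairwise non-overlapping rectangles (tall items) that overlap $B$, each of height at least $(1/3+\varepsilon)\mathrm{OPT}$ and with left and right borders at integer $x$-coordinates. Assume that no tall item is cut by the bottom or the top border of $B$, that each one touches the bottom or the top of $B$, and that at most one tall item crosses the left border and at most one crosses the right border of $B$. Let $V$ be a finite set of rectangles in $B$ ((slices of) vertical items) that overlap neither each other nor a tall item. The set $P$ of pseudo items is defined as follows. Let $x_0<x_1<\dots<x_k$ be the $x$-coordinates of the left and right borders of $B$ together with the $x$-coordinates strictly between them at which a tall item begins or ends. If the strip $[x_{j-1},x_j)$ of $B$ meets no tall item, the whole strip is a pseudo item; if it meets exactly one tall item, and this one touches the bottom (top) of $B$, the part of the strip above (below) that tall item is a pseudo item (if it has positive height); if it meets two tall items, there is none. Vertical items are sliced along the borders of the pseudo items. Let $S_T$, $S_P$, $S_{T\cup P}$ be the numbers of different heights of the items in $T$, $P$, $T\cup P$. There is an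 absolute constant $C$ such that in every such situation there is a rearrangement of $T\cup P$ with the following properties. It changes only the $x$-coordinates of items, to integers. The tall items that cross the left or right border of $B$ are not moved, and all other items lie in $B$. No two items overlap after the rearrangement. Moreover there are pairwise non-overlapping rectangular subboxes of $B$, at most $C\,(S_P+S_T)\,S_{T\cup P}$ in total and with borders at integer $x$-coordinates, each of which is either a subbox for tall items or a subbox for vertical items, such that * each tall item (the part of it in $B$, if it crosses the border) is contained in a subbox for tall items, and each subbox $B_T$ for tall items contains only tall items, all of height exactly $h(B_T)$; * each pseudo item is contained in a subbox for vertical items; * all (slices of) vertical items in $B$ that are covered by pseudo items in the original packing can be packed fractionally into the subboxes for vertical items, that is, after cutting them by vertical lines into finitely many slices, these slices can be placed without overlap in these subboxes. -/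

import Mathlib

namespace StripPacking

/-- An axis-parallel rectangle with left bottom corner `(x, y)`, width `w` and height `h`. -/
structure Rect where
  x : ℝ
  y : ℝ
  w : ℝ
  h : ℝ

namespace Rect

/-- Width and height are positive. -/
def Pos (r : Rect) : Prop := 0 < r.w ∧ 0 < r.h

/-- The left and the right border lie at integer x-coordinates. -/
def OnGrid (r : Rect) : Prop := (∃ a : ℤ, r.x = a) ∧ ∃ b : ℤ, r.w = b

/-- `r` and `s` overlap: their interiors meet (for rectangles of positive width and height). -/
def Overlaps (r s : Rect) : Prop :=
  r.x < s.x + s.w ∧ s.x < r.x + r.w ∧ r.y < s.y + s.h ∧ s.y < r.y + r.h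

/-- `r` is contained in `s`. -/
def Inside (r s : Rect) : Prop :=
  s.x ≤ r.x ∧ r.x + r.w ≤ s.x + s.w ∧ s.y ≤ r.y ∧ r.y + r.h ≤ s.y + s.h

/-- The intersection of two overlapping rectangles. -/
noncomputable def inter (r s : Rect) : Rect where
  x := max r.x s.x
  y := max r.y s.y
  w := min (r.x + r.w) (s.x + s.w) - max r.x s.x
  h := min (r.y + r.h) (s.y + s.h) - max r.y s.y

/-- `r`, shifted horizontally so that its left border is at `a`. -/
def moveTo (r : Rect) (a : ℝ) : Rect := { r with x := a }

/-- The item `r` overlaps the left border of the box `B`. -/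
def CrossesLeft (r B : Rect) : Prop := r.x < B.x ∧ B.x < r.x + r.w

/-- The item `r` overlaps the right border of the box `B`. -/
def CrossesRight (r B : Rect) : Prop := r.x < B.x + B.w ∧ B.x + B.w < r.x + r.w

/-- The item `r` touches the bottom of the box `B`. -/
def TouchesBottom (r B : Rect) : Prop := r.y = B.y

/-- The item `r` touches the top of the box `B`. -/
def TouchesTop (r B : Rect) : Prop := r.y + r.h = B.y + B.h

/-- The item `r` meets the interior of the vertical strip between the x-coordinates `a < b`. -/
def MeetsStrip (r : Rect) (a b : ℝ) : Prop := r.x < b ∧ a < r.x + r.w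

end Rect

/-- No two different rectangles of the set overlap. -/
def NonOverlapping (A : Set Rect) : Prop := A.Pairwise fun r s => ¬ r.Overlaps s

/-- The situation in one box `B` for tall and vertical items: `B` has height at least
`(2/3 + 2ε) OPT`; `T` is the set of the tall items (height at least `(1/3 + ε) OPT`) that meet `B`,
`V` is the set of the (slices of) vertical items in `B`. The tall items are not cut by the top and
the bottom border of `B`, each of them touches one of these two borders, and at most one of them
overlaps the left (right) border of `B`. -/
structure IsLargeBox (ε OPT : ℝ) (B : Rect) (T V : Finset Rect) : Prop where
  box_width : 0 < B.w
  box_height : (2 / 3 + 2 * ε) * OPT ≤ B.h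
  box_grid : B.OnGrid
  tall_pos : ∀ t ∈ T, t.Pos
  tall_height : ∀ t ∈ T, (1 / 3 + ε) * OPT ≤ t.h
  tall_grid : ∀ t ∈ T, t.OnGrid
  tall_meets : ∀ t ∈ T, t.Overlaps B
  tall_within : ∀ t ∈ T, B.y ≤ t.y ∧ t.y + t.h ≤ B.y + B.h
  tall_touches : ∀ t ∈ T, t.TouchesBottom B ∨ t.TouchesTop B
  crossing_left : ∀ s ∈ T, ∀ t ∈ T, s.CrossesLeft B → t.CrossesLeft B → s = t
  crossing_right : ∀ s ∈ T, ∀ t ∈ T, s.CrossesRight B → t.CrossesRight B → s = t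
  vertical_pos : ∀ v ∈ V, v.Pos
  vertical_inside : ∀ v ∈ V, v.Inside B
  feasible_tall : NonOverlapping (T : Set Rect)
  feasible_vertical : NonOverlapping (V : Set Rect)
  feasible_mixed : ∀ t ∈ T, ∀ v ∈ V, ¬ t.Overlaps v

/-- The x-coordinates of the left and right borders of `B` and, inside of `B`, of the left and right
borders of the tall items. -/
def breakpoints (B : Rect) (T : Finset Rect) : Set ℝ :=
  {c | c = B.x ∨ c = B.x + B.w ∨
    (B.x < c ∧ c < B.x + B.w ∧ ∃ t ∈ T, c = t.x ∨ c = t.x + t.w)}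

/-- `a < b` are consecutive breakpoints. -/
def IsStrip (B : Rect) (T : Finset Rect) (a b : ℝ) : Prop :=
  a ∈ breakpoints B T ∧ b ∈ breakpoints B T ∧ a < b ∧ ∀ c ∈ breakpoints B T, ¬ (a < c ∧ c < b)

/-- The pseudo items of the box `B`. In a strip between consecutive breakpoints that meets no tall
item the whole strip is a pseudo item; in a strip that meets exactly one tall item the pseudo item
is the part of the strip above (below) that tall item, if the tall item touches the bottom (top) of
`B`; in a strip that meets two tall items there is none. -/
inductive IsPseudo (B : Rect) (T : Finset Rect) : Rect → Prop
  | full (a b : ℝ) (hs : IsStrip B T a b) (hno : ∀ t ∈ T, ¬ t.MeetsStrip a b) :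
      IsPseudo B T { x := a, y := B.y, w := b - a, h := B.h }
  | above (a b : ℝ) (hs : IsStrip B T a b) (t : Rect) (ht : t ∈ T) (hm : t.MeetsStrip a b)
      (hu : ∀ s ∈ T, s.MeetsStrip a b → s = t) (hb : t.TouchesBottom B) (hh : t.h < B.h) :
      IsPseudo B T { x := a, y := B.y + t.h, w := b - a, h := B.h - t.h }
  | below (a b : ℝ) (hs : IsStrip B T a b) (t : Rect) (ht : t ∈ T) (hm : t.MeetsStrip a b)
      (hu : ∀ s ∈ T, s.MeetsStrip a b → s = t) (hb : t.TouchesTop B) (hh : t.h < B.h) :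
      IsPseudo B T { x := a, y := B.y, w := b - a, h := B.h - t.h }

/-- The set of the pseudo items of the box `B`. -/
def pseudoItems (B : Rect) (T : Finset Rect) : Set Rect := {p | IsPseudo B T p}

/-- The number of item sizes, that is, of different item heights. -/
noncomputable def numSizes (A : Set Rect) : ℕ := (Rect.h '' A).ncard

/-- The (slices of) vertical items that are covered by pseudo items: the vertical items are sliced
along the borders of the pseudo items. -/
def coveredSlices (B : Rect) (T V : Finset Rect) : Set Rect :=
  {r | ∃ v ∈ V, ∃ p ∈ pseudoItems B T, v.Overlaps p ∧ r = v.inter p}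

/-- A feasible reordering of the items in `T ∪ P`, where `ξ r` is the new x-coordinate of the item
`r`: only x-coordinates change, a tall item that overlaps the left or right border of the box does
not move, all other items stay in the box, and no two items overlap. -/
structure IsReordering (B : Rect) (T : Finset Rect) (ξ : Rect → ℝ) : Prop where
  grid : ∀ r ∈ (T : Set Rect) ∪ pseudoItems B T, ∃ a : ℤ, ξ r = a
  fixed : ∀ t ∈ T, t.CrossesLeft B ∨ t.CrossesRight B → ξ t = t.x
  movable : ∀ r ∈ (T : Set Rect) ∪ pseudoItems B T,
    ¬ (r.CrossesLeft B ∨ r.CrossesRight B) → (r.moveTo (ξ r)).Inside B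
  feasible : ((T : Set Rect) ∪ pseudoItems B T).Pairwise
    fun r s => ¬ (r.moveTo (ξ r)).Overlaps (s.moveTo (ξ s))

open Classical in
/-- The items in `A` can be packed fractionally into the boxes in `U`: every item is cut by vertical
lines into finitely many slices (same height, the widths sum up to the width of the item), and the
slices are placed into the boxes without overlapping. -/
def FractionallyPacks (A : Set Rect) (U : Finset Rect) : Prop :=
  ∃ (n : ℕ) (item slice : Fin n → Rect),
    (∀ k, item k ∈ A ∧ (slice k).h = (item k).h ∧ 0 < (slice k).w ∧
      ∃ u ∈ U, (slice k).Inside u) ∧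
    (∀ k l, k ≠ l → ¬ (slice k).Overlaps (slice l)) ∧
    ∀ a ∈ A, ∑ k ∈ Finset.univ.filter (fun k => item k = a), (slice k).w = a.w

/-- `BT` (subboxes for tall items) and `BV` (subboxes for vertical items) are subboxes of `B` for
the reordering `ξ`: they are pairwise non-overlapping rectangles in `B`; every tall item (as far as
it lies in `B`) is contained in a subbox for tall items of exactly its height, and such a subbox
meets only tall items of that height; every pseudo item is contained in a subbox for vertical
items. -/
structure IsSubboxPartition (B : Rect) (T : Finset Rect) (ξ : Rect → ℝ) (BT BV : Finset Rect) :
    Prop where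
  pos : ∀ b ∈ (BT : Set Rect) ∪ BV, b.Pos
  grid : ∀ b ∈ (BT : Set Rect) ∪ BV, b.OnGrid
  inside : ∀ b ∈ (BT : Set Rect) ∪ BV, b.Inside B
  separate : Disjoint BT BV
  nonOverlapping : NonOverlapping ((BT : Set Rect) ∪ BV)
  tall : ∀ t ∈ T, ∃ b ∈ BT, b.h = t.h ∧ ((t.moveTo (ξ t)).inter B).Inside b
  tall_only : ∀ b ∈ BT, ∀ r ∈ (T : Set Rect) ∪ pseudoItems B T,
    (r.moveTo (ξ r)).Overlaps b → r ∈ T ∧ r.h = b.h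
  pseudo : ∀ p ∈ pseudoItems B T, ∃ b ∈ BV, (p.moveTo (ξ p)).Inside b

end StripPacking

/-! Every tall item and every pseudo item touches the bottom or the top of `B`, so the items form
two rows. Two items meet vertically exactly when they share a row or their heights add up to more
than `h(B)`. The geometry thus reduces to integer intervals in which only such conflicting pairs
must stay disjoint (`TwoRows`).

In an interval `[p, q]`, push one row against the right border with its highest items rightmost, and
the other row against the left border with its highest items leftmost. If two items of different
rows conflict, then so do all items at least as high as them in their rows. All these items were
disjoint before, hence their total width is at most `q - p` and the two stacks still do not collide.
Items of equal row, kind and height become contiguous and fill one slot (`Oriented.arrangeable`).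
This tolerates immovable items that cross the borders, provided that they fit with everything in the
opposite row and that each row sticks out on its proper side only.

The general case is reduced to this one by vertical cuts. A cut at an end of a highest item of a row
is crossed by at most one item, which lies in the other row and fits with the whole row of the
highest item (`cut_at_highest`). If the item crossing the left border does not fit, cutting at the
leftmost of the highest items of the opposite row removes a height from that row to the left of the
cut (`exists_cut`). So there are at most as many such cuts as heights, and each costs a number of
slots linear in the number of attributes. Reflection treats the other border, and one further cut
separates two bad borders.

Slots are completely filled by their items, so the corresponding rectangles do not overlap and
become the subboxes. Slices of vertical items travel with the pseudo items that cover them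
(`fractionallyPacks_of_move`). -/

namespace StripPacking

/-! ### Items in two rows as integer intervals -/

/-- Items in two rows (`row i` tells whether the item lies at the bottom), each occupying an integer
interval; two items in the same row, or in different rows with total height more than `H`, occupy
disjoint intervals. -/
structure TwoRows (ι : Type*) where
  row : ι → Bool
  tall : ι → Bool
  l : ι → ℤ
  r : ι → ℤ
  h : ι → ℝ
  H : ℝ
  lt : ∀ i, l i < r i
  sep : ∀ i j, i ≠ j → (row i = row j ∨ H < h i + h j) → r i ≤ l j ∨ r j ≤ l i

/-- An interval reserved for items with given row, kind and height. -/
structure Slot where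
  attr : Bool × Bool × ℝ
  left : ℤ
  right : ℤ

instance : Nonempty Slot := ⟨⟨(true, true, 0), 0, 0⟩⟩

/-- Disjoint intervals consist of disjoint sets of unit cells, so it suffices to count cells in `[p,
q)`. -/
theorem sum_width_le {ι : Type*} (M : Finset ι) (l r : ι → ℤ) (p q : ℤ) (hpq : p ≤ q)
    (hlt : ∀ i ∈ M, l i < r i) (hin : ∀ i ∈ M, p ≤ l i ∧ r i ≤ q)
    (hsep : ∀ i ∈ M, ∀ j ∈ M, i ≠ j → r i ≤ l j ∨ r j ≤ l i) :
    ∑ i ∈ M, (r i - l i) ≤ q - p := by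
  classical
  have h1 : (M.biUnion fun i => Finset.Ico (l i) (r i)).card
      = ∑ i ∈ M, (Finset.Ico (l i) (r i)).card := by
    apply Finset.card_biUnion
    intro i hi j hj hij
    rw [Function.onFun, Finset.disjoint_left]
    intro x hx hy
    rw [Finset.mem_Ico] at hx hy
    rcases hsep i hi j hj hij with h | h <;> omega
  have h2 : (M.biUnion fun i => Finset.Ico (l i) (r i)) ⊆ Finset.Ico p q := by
    intro x hx
    rw [Finset.mem_biUnion] at hx
    obtain ⟨i, hi, hx⟩ := hx
    rw [Finset.mem_Ico] at hx ⊢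
    have := hin i hi
    omega
  have h3 := Finset.card_le_card h2
  rw [h1] at h3
  have h4 : ((∑ i ∈ M, (Finset.Ico (l i) (r i)).card : ℕ) : ℤ) = ∑ i ∈ M, (r i - l i) := by
    push_cast
    apply Finset.sum_congr rfl
    intro i hi
    have := hlt i hi
    rw [Int.card_Ico]
    omega
  rw [Int.card_Ico] at h3
  omega

/-! ### Stacks sorted by decreasing key -/

section Stack

variable {ι κ : Type*} [LinearOrder κ]

/-- The total width of the members of `M` with a larger key than `i`. -/
def widthAbove (M : Finset ι) (key : ι → κ) (w : ι → ℤ) (i : ι) : ℤ :=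
  ∑ j ∈ M.filter (fun j => key i < key j), w j

variable {M : Finset ι} {key : ι → κ} {w : ι → ℤ}

theorem widthAbove_add_eq (hkey : Function.Injective key) {i : ι} (hi : i ∈ M) :
    widthAbove M key w i + w i = ∑ j ∈ M.filter (fun j => key i ≤ key j), w j := by
  classical
  have : M.filter (fun j => key i ≤ key j) = insert i (M.filter (fun j => key i < key j)) := by
    ext j
    simp only [Finset.mem_filter, Finset.mem_insert]
    constructor
    · rintro ⟨hj, hle⟩
      rcases hle.eq_or_lt with h | h
      · exact Or.inl (hkey h).symm
      · exact Or.inr ⟨hj, h⟩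
    · rintro (rfl | ⟨hj, h⟩)
      · exact ⟨hi, le_rfl⟩
      · exact ⟨hj, h.le⟩
  rw [this, Finset.sum_insert (by simp), widthAbove, add_comm]

theorem widthAbove_nonneg (hw : ∀ i, 0 < w i) (i : ι) : 0 ≤ widthAbove M key w i :=
  Finset.sum_nonneg fun j _ => (hw j).le

theorem widthAbove_add_le (hkey : Function.Injective key) (hw : ∀ i, 0 < w i) {i j : ι}
    (hj : j ∈ M) (hij : key i < key j) :
    widthAbove M key w j + w j ≤ widthAbove M key w i := by
  rw [widthAbove_add_eq hkey hj]
  apply Finset.sum_le_sum_of_subset_of_nonneg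
  · intro k hk
    rw [Finset.mem_filter] at hk ⊢
    exact ⟨hk.1, hij.trans_le hk.2⟩
  · intro k _ _
    exact (hw k).le

theorem widthAbove_add_le_sum (hkey : Function.Injective key) (hw : ∀ i, 0 < w i) {i : ι}
    (hi : i ∈ M) : widthAbove M key w i + w i ≤ ∑ j ∈ M, w j := by
  rw [widthAbove_add_eq hkey hi]
  apply Finset.sum_le_sum_of_subset_of_nonneg (Finset.filter_subset _ _)
  intro k _ _
  exact (hw k).le

/-- The intervals from `widthAbove` to `widthAbove + w` cover everything up to the total width. -/
theorem exists_mem_stack (hkey : Function.Injective key) (hM : M.Nonempty) {x : ℤ}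
    (hx0 : 0 ≤ x) (hx : x < ∑ j ∈ M, w j) :
    ∃ i ∈ M, widthAbove M key w i ≤ x ∧ x < widthAbove M key w i + w i := by
  classical
  obtain ⟨m, hm, hmax⟩ := Finset.exists_max_image M key hM
  have hne : (M.filter fun i => widthAbove M key w i ≤ x).Nonempty := by
    refine ⟨m, Finset.mem_filter.2 ⟨hm, ?_⟩⟩
    have : M.filter (fun j => key m < key j) = ∅ := by
      apply Finset.filter_false_of_mem
      intro j hj
      exact not_lt.2 (hmax j hj)
    rw [widthAbove, this, Finset.sum_empty]
    exact hx0
  obtain ⟨i, hi, hmin⟩ := Finset.exists_min_image _ key hne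
  rw [Finset.mem_filter] at hi
  refine ⟨i, hi.1, hi.2, ?_⟩
  by_contra hcon
  rw [not_lt] at hcon
  rcases (M.filter fun j => key j < key i).eq_empty_or_nonempty with he | hne'
  · have : M.filter (fun j => key i ≤ key j) = M := by
      apply Finset.filter_true_of_mem
      intro j hj
      by_contra h
      have : j ∈ M.filter fun j => key j < key i := Finset.mem_filter.2 ⟨hj, not_le.1 h⟩
      rw [he] at this
      simp at this
    rw [widthAbove_add_eq hkey hi.1, this] at hcon
    omega
  -- `k` has the next smaller key and starts where `i` ends. So it also starts at or before `x`,
  -- against the minimality of `i`.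
  · obtain ⟨k, hk, hkmax⟩ := Finset.exists_max_image _ key hne'
    rw [Finset.mem_filter] at hk
    have : widthAbove M key w k = widthAbove M key w i + w i := by
      rw [widthAbove_add_eq hkey hi.1, widthAbove]
      congr 1
      ext j
      simp only [Finset.mem_filter]
      refine and_congr_right fun hj => ⟨fun h => ?_, fun h => hk.2.trans_le h⟩
      by_contra h'
      exact absurd h (not_lt.2 (hkmax j (Finset.mem_filter.2 ⟨hj, not_le.1 h'⟩)))
    have := hmin k (Finset.mem_filter.2 ⟨hk.1, by omega⟩)
    exact absurd hk.2 (not_lt.2 this)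

/-- Members of a stack in the same class of a monotone classification fill an interval. -/
theorem exists_class_interval {α : Type*} [PartialOrder α] (hkey : Function.Injective key)
    (hw : ∀ i, 0 < w i) (c : ι → α) (hc : ∀ i j, key i ≤ key j → c i ≤ c j) {i₀ : ι}
    (hi₀ : i₀ ∈ M) :
    ∃ a b : ℤ, a < b ∧
      (∀ i ∈ M, c i = c i₀ → a ≤ widthAbove M key w i ∧ widthAbove M key w i + w i ≤ b) ∧
      ∀ x, a ≤ x → x < b → ∃ i ∈ M, c i = c i₀ ∧ widthAbove M key w i ≤ x ∧
        x < widthAbove M key w i + w i := by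
  classical
  have hne : (M.filter fun i => c i = c i₀).Nonempty := ⟨i₀, Finset.mem_filter.2 ⟨hi₀, rfl⟩⟩
  obtain ⟨u, hu, hmax⟩ := Finset.exists_max_image _ key hne
  obtain ⟨d, hd, hmin⟩ := Finset.exists_min_image _ key hne
  have hle : ∀ i ∈ M, c i = c i₀ →
      widthAbove M key w u ≤ widthAbove M key w i ∧
      widthAbove M key w i + w i ≤ widthAbove M key w d + w d := by
    intro i hi hci
    have h1 := hmax i (Finset.mem_filter.2 ⟨hi, hci⟩)
    have h2 := hmin i (Finset.mem_filter.2 ⟨hi, hci⟩)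
    rw [Finset.mem_filter] at hu hd
    constructor
    · rcases h1.eq_or_lt with h | h
      · rw [hkey h]
      · have := widthAbove_add_le (w := w) hkey hw hu.1 h
        have := hw u
        omega
    · rcases h2.eq_or_lt with h | h
      · rw [hkey h]
      · have := widthAbove_add_le (w := w) hkey hw hi h
        have := hw d
        omega
  refine ⟨widthAbove M key w u, widthAbove M key w d + w d, ?_, hle, ?_⟩
  · have := hle i₀ hi₀ rfl
    have := hw i₀
    omega
  · intro x hxa hxb
    rw [Finset.mem_filter] at hu hd
    obtain ⟨i, hi, h1, h2⟩ := exists_mem_stack (w := w) hkey ⟨i₀, hi₀⟩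
      ((widthAbove_nonneg hw u).trans hxa)
      (hxb.trans_le (widthAbove_add_le_sum hkey hw hd.1))
    refine ⟨i, hi, ?_, h1, h2⟩
    -- A cell between the start of `u` and the end of `d` belongs to a member with key between
    -- theirs; monotonicity of `c` then forces its class.
    have hiu : key i ≤ key u := by
      by_contra h
      have := widthAbove_add_le (w := w) hkey hw hi (not_le.1 h)
      omega
    have hdi : key d ≤ key i := by
      by_contra h
      have := widthAbove_add_le (w := w) hkey hw hd.1 (not_le.1 h)
      omega
    exact le_antisymm ((hc i u hiu).trans_eq hu.2) (hd.2.symm.trans_le (hc d i hdi))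

end Stack

end StripPacking

/-! ### Arrangements in slots and their gluing -/

namespace StripPacking
namespace TwoRows

variable {ι : Type*} (D : TwoRows ι)

/-- Row, kind and height of an item. -/
def attr (i : ι) : Bool × Bool × ℝ := (D.row i, D.tall i, D.h i)

/-- The width of an item. -/
def w (i : ι) : ℤ := D.r i - D.l i

/-- The item lies in `[p, q]`. -/
def Inner (p q : ℤ) (i : ι) : Prop := p ≤ D.l i ∧ D.r i ≤ q

/-- The item meets the interior of `[p, q]`. -/
def Meets (p q : ℤ) (i : ι) : Prop := D.l i < q ∧ p < D.r i

/-- The item overlaps the vertical line at `m`. -/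
def Straddles (m : ℤ) (i : ι) : Prop := D.l i < m ∧ m < D.r i

/-- At most one item overlaps the vertical line at `m`. -/
def UniqueAt (m : ℤ) : Prop := ∀ i j, D.Straddles m i → D.Straddles m j → i = j

/-- `ξ` rearranges the items inside `[p, q]` and `σ` puts them into slots in `G`; each slot is
filled by its items, which have its attributes. -/
structure Arrangement (p q : ℤ) (ξ : ι → ℤ) (σ : ι → Slot) (G : Finset Slot) : Prop where
  outer : ∀ i, ¬ D.Inner p q i → ξ i = D.l i
  inner : ∀ i, D.Inner p q i → p ≤ ξ i ∧ ξ i + D.w i ≤ q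
  sep : ∀ i j, i ≠ j → (D.row i = D.row j ∨ D.H < D.h i + D.h j) →
    ξ i + D.w i ≤ ξ j ∨ ξ j + D.w j ≤ ξ i
  cover : ∀ i, D.Inner p q i → σ i ∈ G ∧ (σ i).attr = D.attr i ∧ (σ i).left ≤ ξ i ∧
    ξ i + D.w i ≤ (σ i).right
  fill : ∀ g ∈ G, g.left < g.right ∧ ∀ x, g.left ≤ x → x < g.right →
    ∃ i, D.Inner p q i ∧ σ i = g ∧ ξ i ≤ x ∧ x < ξ i + D.w i

/-- The items inside `[p, q]` have an arrangement with at most `n` slots. -/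
def Arrangeable (p q : ℤ) (n : ℕ) : Prop :=
  ∃ (ξ : ι → ℤ) (σ : ι → Slot) (G : Finset Slot), D.Arrangement p q ξ σ G ∧ G.card ≤ n

variable {D}

theorem w_pos (i : ι) : 0 < D.w i := by
  have := D.lt i
  unfold w
  omega

theorem Arrangeable.mono {p q : ℤ} {n m : ℕ} (h : D.Arrangeable p q n) (hnm : n ≤ m) :
    D.Arrangeable p q m := by
  obtain ⟨ξ, σ, G, h1, h2⟩ := h
  exact ⟨ξ, σ, G, h1, h2.trans hnm⟩

/-- Arrangements of adjacent intervals can be combined; the item that overlaps the common border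
gets its own slot. -/
theorem Arrangeable.glue {p m q : ℤ} {a b : ℕ} (hpm : p ≤ m) (hmq : m ≤ q)
    (h1 : D.Arrangeable p m a) (hU : D.UniqueAt m) (h2 : D.Arrangeable m q b) :
    D.Arrangeable p q (a + b + 1) := by
  classical
  obtain ⟨ξ₁, σ₁, G₁, A₁, c₁⟩ := h1
  obtain ⟨ξ₂, σ₂, G₂, A₂, c₂⟩ := h2
  have hS : ∃ S : Finset Slot, S.card ≤ 1 ∧
      (∀ i, D.Straddles m i → D.Inner p q i → ⟨D.attr i, D.l i, D.r i⟩ ∈ S) ∧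
      ∀ g ∈ S, ∃ i, D.Straddles m i ∧ D.Inner p q i ∧ g = ⟨D.attr i, D.l i, D.r i⟩ := by
    by_cases hex : ∃ i, D.Straddles m i ∧ D.Inner p q i
    · obtain ⟨i, hi, hi'⟩ := hex
      refine ⟨{⟨D.attr i, D.l i, D.r i⟩}, by simp, ?_, ?_⟩
      · intro j hj _
        rw [hU j i hj hi]
        simp
      · intro g hg
        exact ⟨i, hi, hi', by simpa using hg⟩
    · refine ⟨∅, by simp, fun i hi hi' => (hex ⟨i, hi, hi'⟩).elim, by simp⟩
  obtain ⟨S, cS, hS1, hS2⟩ := hS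
  have hnot : ∀ i, D.Inner p m i → ¬ D.Inner m q i := by
    intro i h h'
    have := D.lt i
    unfold Inner at h h'
    omega
  have hin1 : ∀ i, D.Inner p m i → D.Inner p q i := fun i h => ⟨h.1, h.2.trans hmq⟩
  have hin2 : ∀ i, D.Inner m q i → D.Inner p q i := fun i h => ⟨hpm.trans h.1, h.2⟩
  -- For items inside neither half, `ξ₂` is the old position, so no third case is needed.
  set ξ : ι → ℤ := fun i => if D.Inner p m i then ξ₁ i else ξ₂ i with hξ
  have e1 : ∀ i, D.Inner p m i → ξ i = ξ₁ i := fun i h => by simp [hξ, h]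
  have e2 : ∀ i, D.Inner m q i → ξ i = ξ₂ i := fun i h => by
    have : ¬ D.Inner p m i := fun h' => hnot i h' h
    simp [hξ, this]
  have e3 : ∀ i, ¬ D.Inner p m i → ¬ D.Inner m q i → ξ i = D.l i := fun i h h' => by
    simp [hξ, h, A₂.outer i h']
  set σ : ι → Slot := fun i => if D.Inner p m i then σ₁ i else
    if D.Inner m q i then σ₂ i else ⟨D.attr i, D.l i, D.r i⟩ with hσ
  have s1 : ∀ i, D.Inner p m i → σ i = σ₁ i := fun i h => by simp [hσ, h]
  have s2 : ∀ i, D.Inner m q i → σ i = σ₂ i := fun i h => by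
    have : ¬ D.Inner p m i := fun h' => hnot i h' h
    simp [hσ, h, this]
  have s3 : ∀ i, ¬ D.Inner p m i → ¬ D.Inner m q i → σ i = ⟨D.attr i, D.l i, D.r i⟩ :=
    fun i h h' => by simp [hσ, h, h']
  have hstr : ∀ i, D.Inner p q i → ¬ D.Inner p m i → ¬ D.Inner m q i → D.Straddles m i := by
    intro i h h' h''
    unfold Inner at h h' h''
    unfold Straddles
    omega
  refine ⟨ξ, σ, G₁ ∪ G₂ ∪ S, ⟨?_, ?_, ?_, ?_, ?_⟩, ?_⟩
  · intro i hi
    exact e3 i (fun h => hi (hin1 i h)) (fun h => hi (hin2 i h))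
  · intro i hi
    by_cases h : D.Inner p m i
    · rw [e1 i h]
      have := A₁.inner i h
      omega
    · by_cases h' : D.Inner m q i
      · rw [e2 i h']
        have := A₂.inner i h'
        omega
      · rw [e3 i h h']
        unfold Inner at hi
        unfold w
        omega
  · intro i j hij hc
    by_cases hi : D.Inner p m i
    · by_cases hj' : D.Inner m q j
      · rw [e1 i hi, e2 j hj']
        have := A₁.inner i hi
        have := A₂.inner j hj'
        omega
      · have : ξ j = ξ₁ j := by
          by_cases hj : D.Inner p m j
          · exact e1 j hj
          · rw [e3 j hj hj', A₁.outer j hj]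
        rw [e1 i hi, this]
        exact A₁.sep i j hij hc
    · by_cases hj : D.Inner p m j
      · by_cases hi' : D.Inner m q i
        · rw [e1 j hj, e2 i hi']
          have := A₁.inner j hj
          have := A₂.inner i hi'
          omega
        · rw [e1 j hj, e3 i hi hi', ← A₁.outer i hi]
          exact A₁.sep i j hij hc
      · simp only [hξ, hi, hj, if_false]
        exact A₂.sep i j hij hc
  · intro i hi
    by_cases h : D.Inner p m i
    · rw [e1 i h, s1 i h]
      obtain ⟨hg, hh⟩ := A₁.cover i h
      exact ⟨by simp [hg], hh⟩
    · by_cases h' : D.Inner m q i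
      · rw [e2 i h', s2 i h']
        obtain ⟨hg, hh⟩ := A₂.cover i h'
        exact ⟨by simp [hg], hh⟩
      · rw [e3 i h h', s3 i h h']
        refine ⟨Finset.mem_union_right _ (hS1 i (hstr i hi h h') hi), rfl, ?_⟩
        simp [w]
  · intro g hg
    rw [Finset.mem_union, Finset.mem_union] at hg
    rcases hg with (hg | hg) | hg
    · refine ⟨(A₁.fill g hg).1, fun x hx hx' => ?_⟩
      obtain ⟨i, hi, hh⟩ := (A₁.fill g hg).2 x hx hx'
      exact ⟨i, hin1 i hi, by rwa [e1 i hi, s1 i hi]⟩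
    · refine ⟨(A₂.fill g hg).1, fun x hx hx' => ?_⟩
      obtain ⟨i, hi, hh⟩ := (A₂.fill g hg).2 x hx hx'
      exact ⟨i, hin2 i hi, by rwa [e2 i hi, s2 i hi]⟩
    · obtain ⟨i, hi, hi', rfl⟩ := hS2 g hg
      have := D.lt i
      unfold Straddles at hi
      have n1 : ¬ D.Inner p m i := fun h => by unfold Inner at h; omega
      have n2 : ¬ D.Inner m q i := fun h => by unfold Inner at h; omega
      refine ⟨this, fun x hx hx' => ⟨i, hi', s3 i n1 n2, ?_⟩⟩
      rw [e3 i n1 n2]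
      dsimp only at hx hx'
      unfold w
      omega
  · refine (Finset.card_union_le _ _).trans ?_
    have := Finset.card_union_le G₁ G₂
    omega

/-! ### Sorting the two rows in opposite directions -/

section Oriented

variable (D) in
/-- Items of row `ρ` stick out of `[p, q]` only on the left, items of the other row only on the
right, unless they cover `[p, q]`; those that stick out fit above or below all items. -/
def Oriented (ρ : Bool) (p q : ℤ) : Prop :=
  ∀ j, D.Meets p q j → ¬ D.Inner p q j → (D.l j ≤ p ∧ q ≤ D.r j) ∨
    ((D.row j = ρ → D.r j ≤ q) ∧ (D.row j ≠ ρ → p ≤ D.l j) ∧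
      ∀ i, D.Meets p q i → D.row i ≠ D.row j → D.h i + D.h j ≤ D.H)

variable [Fintype ι]

-- Row `ρ` can be stacked at the right border because it sticks out on the left only; the other row
-- symmetrically. Collisions between the stacks are excluded by the width of the sets of items at
-- least as high as the two in question.
open Classical in
theorem Oriented.arrangeable {ρ : Bool} {p q : ℤ} (hpq : p < q) (hO : D.Oriented ρ p q) :
    D.Arrangeable p q (Finset.univ.image D.attr).card := by
  obtain ⟨e⟩ : Nonempty (ι ≃ Fin (Fintype.card ι)) := ⟨Fintype.equivFin ι⟩
  -- Height decides first. The kind breaks ties so that tall and pseudo items of equal height are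
  -- not mixed, and the enumeration makes the key injective.
  set key : ι → ℝ ×ₗ (Bool ×ₗ Fin (Fintype.card ι)) :=
    fun i => toLex (D.h i, toLex (D.tall i, e i)) with hkeydef
  have hkey : Function.Injective key := by
    intro i j hij
    simp only [hkeydef, EmbeddingLike.apply_eq_iff_eq, Prod.mk.injEq] at hij
    exact hij.2.2
  set c : ι → ℝ ×ₗ Bool := fun i => toLex (D.h i, D.tall i) with hcdef
  have hc : ∀ i j, key i ≤ key j → c i ≤ c j := by
    intro i j hij
    simp only [hkeydef, hcdef, Prod.Lex.toLex_le_toLex] at hij ⊢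
    rcases hij with h | ⟨h, h'⟩
    · exact Or.inl h
    · rcases h' with h' | ⟨h', -⟩
      · exact Or.inr ⟨h, h'.le⟩
      · exact Or.inr ⟨h, h'.le⟩
  have hh : ∀ i j, key i ≤ key j → D.h i ≤ D.h j := by
    intro i j hij
    simp only [hkeydef, Prod.Lex.toLex_le_toLex] at hij
    rcases hij with h | ⟨h, -⟩
    · exact h.le
    · exact h.le
  have hw : ∀ i, 0 < D.w i := w_pos
  set M : Bool → Finset ι := fun σ => Finset.univ.filter fun i => D.row i = σ ∧ D.Inner p q i
    with hM
  have memM : ∀ σ i, i ∈ M σ ↔ D.row i = σ ∧ D.Inner p q i := by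
    intro σ i
    simp [hM]
  set A : Bool → ι → ℤ := fun σ i => widthAbove (M σ) key D.w i with hA
  set ξ : ι → ℤ := fun i => if D.Inner p q i then
    (if D.row i = ρ then q - (A ρ i + D.w i) else p + A (!ρ) i) else D.l i with hξ
  have eo : ∀ i, ¬ D.Inner p q i → ξ i = D.l i := fun i h => by simp [hξ, h]
  have e1 : ∀ i, D.Inner p q i → D.row i = ρ → ξ i = q - (A ρ i + D.w i) :=
    fun i h h' => by simp [hξ, h, h']
  have e2 : ∀ i, D.Inner p q i → D.row i = !ρ → ξ i = p + A (!ρ) i :=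
    fun i h h' => by simp [hξ, h, h']
  have hrow : ∀ i, D.row i = ρ ∨ D.row i = !ρ := by
    intro i
    cases D.row i <;> cases ρ <;> simp
  have hsum : ∀ (N : Finset ι) (p' q' : ℤ), p' ≤ q' → (∀ i ∈ N, p' ≤ D.l i ∧ D.r i ≤ q') →
      (∀ i ∈ N, ∀ j ∈ N, i ≠ j → D.row i = D.row j ∨ D.H < D.h i + D.h j) →
      ∑ i ∈ N, D.w i ≤ q' - p' := by
    intro N p' q' hpq' h1 h2
    exact sum_width_le N D.l D.r p' q' hpq' (fun i _ => D.lt i) h1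
      fun i hi j hj hij => D.sep i j hij (h2 i hi j hj hij)
  have hsumM : ∀ σ p' q', p' ≤ q' → (∀ i ∈ M σ, p' ≤ D.l i ∧ D.r i ≤ q') →
      ∑ i ∈ M σ, D.w i ≤ q' - p' := by
    intro σ p' q' hpq' h1
    refine hsum _ p' q' hpq' h1 fun i hi j hj _ => Or.inl ?_
    rw [((memM _ _).1 hi).1, ((memM _ _).1 hj).1]
  have hAle : ∀ σ i, D.row i = σ → D.Inner p q i → A σ i + D.w i ≤ ∑ i ∈ M σ, D.w i :=
    fun σ i h h' => widthAbove_add_le_sum hkey hw ((memM _ _).2 ⟨h, h'⟩)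
  have hA0 : ∀ σ i, 0 ≤ A σ i := fun σ i => widthAbove_nonneg hw i
  have hinner : ∀ i, D.Inner p q i → p ≤ ξ i ∧ ξ i + D.w i ≤ q := by
    intro i hi
    have h1 : ∀ σ, ∑ i ∈ M σ, D.w i ≤ q - p := fun σ =>
      hsumM σ p q hpq.le fun i hi => ((memM _ _).1 hi).2
    have h1' := h1 ρ
    have h2' := h1 (!ρ)
    have := hw i
    rcases hrow i with h | h
    · rw [e1 i hi h]
      have := hAle _ i h hi
      have := hA0 ρ i
      omega
    · rw [e2 i hi h]
      have := hAle _ i h hi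
      have := hA0 (!ρ) i
      omega
  -- an item inside and one that is not
  have hmixed : ∀ i j, i ≠ j → (D.row i = D.row j ∨ D.H < D.h i + D.h j) → D.Inner p q i →
      ¬ D.Inner p q j → ξ i + D.w i ≤ ξ j ∨ ξ j + D.w j ≤ ξ i := by
    intro i j hij hcl hi hj
    have hji : ξ j + D.w j = D.r j := by rw [eo j hj]; unfold w; omega
    rw [hji, eo j hj]
    have hIi := hinner i hi
    have hlt := D.lt i
    by_cases hm : D.Meets p q j
    -- An item covering `[p, q]` shares cells with every inner item, so it never conflicts with one.
    -- Otherwise the conflict must come from a common row.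
    · rcases hO j hm hj with ⟨h1, h2⟩ | ⟨h1, h2, h3⟩
      · have := D.sep i j hij hcl
        unfold Inner at hi
        omega
      · have hmi : D.Meets p q i := by
          unfold Inner at hi
          unfold Meets
          omega
        have hrij : D.row i = D.row j := by
          rcases hcl with h | h
          · exact h
          · by_contra h'
            exact absurd (h3 i hmi h') (not_le.2 h)
        rcases hrow j with hr | hr
        · have hrj := h1 hr
          right
          -- The inner items of this row lay to the right of `j`, so their stack fits between `j`
          -- and `q`.
          have hs := hsumM ρ (D.r j) q hrj (by
            intro k hk
            obtain ⟨hk1, hk2⟩ := (memM _ _).1 hk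
            have hkj : k ≠ j := fun h => hj (h ▸ hk2)
            have := D.sep k j hkj (Or.inl (hk1.trans hr.symm))
            have := D.lt k
            unfold Inner at hj hk2
            unfold Meets at hm
            omega)
          rw [e1 i hi (hrij.trans hr)]
          have := hAle ρ i (hrij.trans hr) hi
          omega
        · have hrj := h2 (by rw [hr]; simp)
          left
          have hs := hsumM (!ρ) p (D.l j) hrj (by
            intro k hk
            obtain ⟨hk1, hk2⟩ := (memM _ _).1 hk
            have hkj : k ≠ j := fun h => hj (h ▸ hk2)
            have := D.sep k j hkj (Or.inl (hk1.trans hr.symm))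
            have := D.lt k
            unfold Inner at hj hk2
            unfold Meets at hm
            omega)
          rw [e2 i hi (hrij.trans hr)]
          have := hAle (!ρ) i (hrij.trans hr) hi
          omega
    · unfold Meets at hm
      omega
  -- two items inside, in different rows
  have hopp : ∀ i j, D.H < D.h i + D.h j → D.Inner p q i → D.Inner p q j → D.row i = ρ →
      D.row j = !ρ → ξ j + D.w j ≤ ξ i := by
    intro i j hcl hi hj hri hrj
    rw [e1 i hi hri, e2 j hj hrj]
    have h1 := widthAbove_add_eq (M := M ρ) (w := D.w) hkey ((memM _ _).2 ⟨hri, hi⟩)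
    have h2 := widthAbove_add_eq (M := M (!ρ)) (w := D.w) hkey ((memM _ _).2 ⟨hrj, hj⟩)
    set N₁ := (M ρ).filter fun k => key i ≤ key k with hN₁
    set N₂ := (M (!ρ)).filter fun k => key j ≤ key k with hN₂
    have mem1 : ∀ k ∈ N₁, D.row k = ρ ∧ D.Inner p q k ∧ D.h i ≤ D.h k := by
      intro k hk
      rw [hN₁, Finset.mem_filter, memM] at hk
      exact ⟨hk.1.1, hk.1.2, hh _ _ hk.2⟩
    have mem2 : ∀ k ∈ N₂, D.row k = (!ρ) ∧ D.Inner p q k ∧ D.h j ≤ D.h k := by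
      intro k hk
      rw [hN₂, Finset.mem_filter, memM] at hk
      exact ⟨hk.1.1, hk.1.2, hh _ _ hk.2⟩
    have hdisj : Disjoint N₁ N₂ := by
      rw [Finset.disjoint_left]
      intro k hk hk'
      have := (mem1 k hk).1.symm.trans (mem2 k hk').1
      simp at this
    -- Any member of `N₁` conflicts with any member of `N₂`, being at least as high as `i` and `j`.
    -- So all were disjoint originally, and the two partial stacks together fit into `[p, q]`.
    have h3 := hsum (N₁ ∪ N₂) p q hpq.le (by
        intro k hk
        rcases Finset.mem_union.1 hk with hk | hk
        · exact (mem1 k hk).2.1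
        · exact (mem2 k hk).2.1) (by
        intro k hk k' hk' _
        rcases Finset.mem_union.1 hk with hk | hk <;> rcases Finset.mem_union.1 hk' with hk' | hk'
        · exact Or.inl ((mem1 k hk).1.trans (mem1 k' hk').1.symm)
        · right
          have := (mem1 k hk).2.2
          have := (mem2 k' hk').2.2
          linarith
        · right
          have := (mem2 k hk).2.2
          have := (mem1 k' hk').2.2
          linarith
        · exact Or.inl ((mem2 k hk).1.trans (mem2 k' hk').1.symm))
    rw [Finset.sum_union hdisj, ← h1, ← h2] at h3
    simp only [hA]
    omega
  have hsame : ∀ i j, key i < key j → D.Inner p q i → D.Inner p q j → D.row i = D.row j →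
      ξ i + D.w i ≤ ξ j ∨ ξ j + D.w j ≤ ξ i := by
    intro i j hij hi hj hr
    rcases hrow j with h | h
    · rw [e1 i hi (hr.trans h), e1 j hj h]
      have := widthAbove_add_le (M := M ρ) (w := D.w) hkey hw ((memM _ _).2 ⟨h, hj⟩) hij
      simp only [hA]
      omega
    · rw [e2 i hi (hr.trans h), e2 j hj h]
      have := widthAbove_add_le (M := M (!ρ)) (w := D.w) hkey hw ((memM _ _).2 ⟨h, hj⟩) hij
      simp only [hA]
      omega
  have hslot : ∀ α ∈ (Finset.univ.filter (D.Inner p q)).image D.attr, ∃ g : Slot,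
      g.attr = α ∧ (∀ i, D.Inner p q i → D.attr i = α → g.left ≤ ξ i ∧ ξ i + D.w i ≤ g.right) ∧
      g.left < g.right ∧ ∀ x, g.left ≤ x → x < g.right →
        ∃ i, D.Inner p q i ∧ D.attr i = g.attr ∧ ξ i ≤ x ∧ x < ξ i + D.w i := by
    intro α hα
    obtain ⟨k, hk, rfl⟩ := Finset.mem_image.1 hα
    have hk : D.Inner p q k := by simpa using hk
    have hattr : ∀ i, D.attr i = D.attr k ↔ D.row i = D.row k ∧ c i = c k := by
      intro i
      simp only [attr, hcdef, Prod.mk.injEq, EmbeddingLike.apply_eq_iff_eq]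
      tauto
    obtain ⟨a, b, hab, h1, h2⟩ := exists_class_interval (M := M (D.row k)) (w := D.w) hkey hw c hc
      ((memM _ _).2 ⟨rfl, hk⟩)
    rcases hrow k with hr | hr
    · refine ⟨⟨D.attr k, q - b, q - a⟩, rfl, ?_, by dsimp only; omega, ?_⟩
      · intro i hi hia
        obtain ⟨hia, hic⟩ := (hattr i).1 hia
        have := h1 i ((memM _ _).2 ⟨hia, hi⟩) hic
        rw [e1 i hi (hia.trans hr)]
        rw [hr] at this
        simp only [hA]
        omega
      · intro x hx hx'
        dsimp only at hx hx'
        -- This stack grows leftwards from `q`; the unit cell starting at `x` is its cell number `q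
        -- - 1 - x`.
        obtain ⟨i, hi, hic, h3, h4⟩ := h2 (q - 1 - x) (by omega) (by omega)
        obtain ⟨hi1, hi2⟩ := (memM _ _).1 hi
        refine ⟨i, hi2, (hattr i).2 ⟨hi1, hic⟩, ?_⟩
        rw [e1 i hi2 (hi1.trans hr)]
        rw [hr] at h3 h4
        simp only [hA]
        omega
    · refine ⟨⟨D.attr k, p + a, p + b⟩, rfl, ?_, by dsimp only; omega, ?_⟩
      · intro i hi hia
        obtain ⟨hia, hic⟩ := (hattr i).1 hia
        have := h1 i ((memM _ _).2 ⟨hia, hi⟩) hic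
        rw [e2 i hi (hia.trans hr)]
        rw [hr] at this
        simp only [hA]
        omega
      · intro x hx hx'
        dsimp only at hx hx'
        obtain ⟨i, hi, hic, h3, h4⟩ := h2 (x - p) (by omega) (by omega)
        obtain ⟨hi1, hi2⟩ := (memM _ _).1 hi
        refine ⟨i, hi2, (hattr i).2 ⟨hi1, hic⟩, ?_⟩
        rw [e2 i hi2 (hi1.trans hr)]
        rw [hr] at h3 h4
        simp only [hA]
        omega
  choose! f hf using hslot
  refine ⟨ξ, fun i => f (D.attr i), ((Finset.univ.filter (D.Inner p q)).image D.attr).image f,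
    ⟨eo, hinner, ?_, ?_, ?_⟩, ?_⟩
  · intro i j hij hcl
    by_cases hi : D.Inner p q i
    · by_cases hj : D.Inner p q j
      · by_cases hr : D.row i = D.row j
        · rcases lt_trichotomy (key i) (key j) with h | h | h
          · exact hsame i j h hi hj hr
          · exact (hij (hkey h)).elim
          · exact (hsame j i h hj hi hr.symm).symm
        · have hcl := hcl.resolve_left hr
          rcases hrow i with h | h
          · have h' : D.row j = !ρ := (hrow j).resolve_left fun h' => hr (h.trans h'.symm)
            exact Or.inr (hopp i j hcl hi hj h h')
          · have h' : D.row j = ρ := (hrow j).resolve_right fun h' => hr (h.trans h'.symm)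
            rw [add_comm] at hcl
            exact Or.inl (hopp j i hcl hj hi h' h)
      · exact hmixed i j hij hcl hi hj
    · by_cases hj : D.Inner p q j
      · refine (hmixed j i hij.symm ?_ hj hi).symm
        rw [add_comm (D.h j), eq_comm]
        exact hcl
      · rw [eo i hi, eo j hj]
        have := D.sep i j hij hcl
        unfold w
        omega
  · intro i hi
    have hα : D.attr i ∈ (Finset.univ.filter (D.Inner p q)).image D.attr :=
      Finset.mem_image_of_mem _ (by simpa using hi)
    exact ⟨Finset.mem_image_of_mem _ hα, (hf _ hα).1, (hf _ hα).2.1 i hi rfl⟩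
  · intro g hg
    obtain ⟨α, hα, rfl⟩ := Finset.mem_image.1 hg
    obtain ⟨h1, -, h2, h3⟩ := hf α hα
    refine ⟨h2, fun x hx hx' => ?_⟩
    obtain ⟨i, hi, hia, hx⟩ := h3 x hx hx'
    exact ⟨i, hi, by rw [hia, h1], hx⟩
  · exact Finset.card_image_le.trans
      (Finset.card_le_card (Finset.image_subset_image (Finset.filter_subset _ _)))

end Oriented

end TwoRows
end StripPacking

/-! ### Cuts at highest items -/

namespace StripPacking
namespace TwoRows

variable {ι : Type*} (D : TwoRows ι)

/-- Items overlapping the line at `m` fit above or below all items that meet `[p, q]`. -/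
def FitsAt (m p q : ℤ) : Prop :=
  ∀ j, D.Straddles m j → ∀ i, D.Meets p q i → D.row i ≠ D.row j → D.h i + D.h j ≤ D.H

variable {D}

theorem FitsAt.mono {m p q p' q' : ℤ} (h : D.FitsAt m p q) (hp : p ≤ p') (hq : q' ≤ q) :
    D.FitsAt m p' q' :=
  fun j hj i hi => h j hj i ⟨hi.1.trans_le hq, hp.trans_lt hi.2⟩

/-- An item that sticks out without covering `[p, q]` crosses exactly one border, so the condition
splits into one for each border. -/
theorem Oriented.of_fitsAt {ρ : Bool} {p q : ℤ} (hp : D.FitsAt p p q) (hq : D.FitsAt q p q)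
    (h1 : ∀ j, D.Straddles p j → D.r j < q → D.row j = ρ)
    (h2 : ∀ j, D.Straddles q j → p < D.l j → D.row j ≠ ρ) : D.Oriented ρ p q := by
  intro j hm hj
  by_cases hcov : D.l j ≤ p ∧ q ≤ D.r j
  · exact Or.inl hcov
  right
  by_cases hl : D.l j < p
  · have hs : D.Straddles p j := ⟨hl, hm.2⟩
    have hr : D.r j < q := by omega
    exact ⟨fun _ => hr.le, fun h => (h (h1 j hs hr)).elim, hp j hs⟩
  · unfold Inner at hj
    have hs : D.Straddles q j := ⟨hm.1, by omega⟩
    have hl' : p < D.l j := by unfold Straddles at hs; omega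
    exact ⟨fun h => (h2 j hs hl' h).elim, fun _ => hl'.le, hq j hs⟩

theorem eq_of_mem {i j : ι} {x : ℤ} (hi : D.l i ≤ x) (hi' : x < D.r i) (hj : D.l j ≤ x)
    (hj' : x < D.r j) (hr : D.row i = D.row j) : i = j := by
  by_contra h
  have := D.sep i j h (Or.inl hr)
  omega

theorem add_le_of_mem {i j : ι} {x : ℤ} (hi : D.l i ≤ x) (hi' : x < D.r i) (hj : D.l j ≤ x)
    (hj' : x < D.r j) (hr : D.row i ≠ D.row j) : D.h i + D.h j ≤ D.H := by
  by_contra h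
  have := D.sep i j (fun h => hr (by rw [h])) (Or.inr (not_le.1 h))
  omega

/-- A line at an end of an item that is highest in its row among the items meeting `[p, q]`. -/
theorem cut_at_highest {g : ι} {m p q : ℤ} (hmg : m = D.l g ∨ m = D.r g)
    (hmax : ∀ i, D.Meets p q i → D.row i = D.row g → D.h i ≤ D.h g) :
    (∀ j, D.Straddles m j → D.row j ≠ D.row g) ∧ D.UniqueAt m ∧ D.FitsAt m p q := by
  have hlt := D.lt g
  have h1 : ∀ j, D.Straddles m j → D.row j ≠ D.row g := by
    intro j hj hr
    unfold Straddles at hj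
    rcases hmg with rfl | rfl
    · have := eq_of_mem hj.1.le hj.2 le_rfl hlt hr
      subst this
      omega
    -- The last unit cell of `g`; an item crossing its right end contains it too.
    · have := eq_of_mem (x := D.r g - 1) (by omega) (by omega) (by omega) (by omega) hr
      subst this
      omega
  refine ⟨h1, ?_, ?_⟩
  · intro i j hi hj
    have h : D.row i = D.row j := by
      have hi' := h1 i hi
      have hj' := h1 j hj
      revert hi' hj'
      cases D.row i <;> cases D.row j <;> cases D.row g <;> simp
    exact eq_of_mem hi.1.le hi.2 hj.1.le hj.2 h
  · intro j hj i hi hr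
    have hjg := h1 j hj
    have hig : D.row i = D.row g := by
      revert hr hjg
      cases D.row i <;> cases D.row j <;> cases D.row g <;> simp
    have h2 := hmax i hi hig
    have h3 : D.h j + D.h g ≤ D.H := by
      unfold Straddles at hj
      rcases hmg with rfl | rfl
      · exact add_le_of_mem hj.1.le hj.2 le_rfl hlt hjg
      · exact add_le_of_mem (x := D.r g - 1) (by omega) (by omega) (by omega) (by omega) hjg
    linarith

variable [Fintype ι]

-- The only obstacle to an orientation is that the items sticking out left and right lie in the same
-- row. A cut at a highest item of that row is crossed only by the other row, which makes both
-- halves oriented, with opposite orientations.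
open Classical in
theorem arrangeable_of_fitsAt {p q : ℤ} (hpq : p < q) (hUp : D.UniqueAt p) (hUq : D.UniqueAt q)
    (hp : D.FitsAt p p q) (hq : D.FitsAt q p q) :
    D.Arrangeable p q (2 * (Finset.univ.image D.attr).card + 1) := by
  by_cases hs : ∃ s s', D.Straddles p s ∧ D.r s < q ∧ D.Straddles q s' ∧ p < D.l s' ∧
      D.row s = D.row s'
  · obtain ⟨s, s', hs, hsq, hs', hps', hss⟩ := hs
    obtain ⟨g, hg, hgmax⟩ := Finset.exists_max_image
      (Finset.univ.filter fun i => D.Meets p q i ∧ D.row i = D.row s) D.h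
      ⟨s, by
        have := D.lt s
        unfold Straddles at hs
        simp only [Finset.mem_filter, Finset.mem_univ, true_and, and_true]
        unfold Meets
        omega⟩
    simp only [Finset.mem_filter, Finset.mem_univ, true_and] at hg hgmax
    -- If the left end of `g` is not inside, `g` and `s` share the cell at `p` in one row, so `g =
    -- s`, whose right end is inside.
    have hm : ∃ m, (m = D.l g ∨ m = D.r g) ∧ p < m ∧ m < q := by
      unfold Meets at hg
      unfold Straddles at hs
      by_cases h : p < D.l g
      · exact ⟨_, Or.inl rfl, h, hg.1.1⟩
      · refine ⟨_, Or.inr rfl, hg.1.2, ?_⟩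
        by_contra h'
        have := eq_of_mem (x := p) hs.1.le hs.2 (not_lt.1 h) hg.1.2 hg.2.symm
        subst this
        omega
    obtain ⟨m, hmg, hpm, hmq⟩ := hm
    obtain ⟨h1, hUm, hFm⟩ := cut_at_highest (p := p) (q := q) hmg
      fun i hi hr => hgmax i ⟨hi, hr.trans hg.2⟩
    rw [hg.2] at h1
    have hO1 : D.Oriented (D.row s) p m := by
      refine .of_fitsAt (hp.mono le_rfl hmq.le) (hFm.mono le_rfl hmq.le) ?_ fun j hj _ => h1 j hj
      intro j hj _
      rw [hUp j s hj hs]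
    have hO2 : D.Oriented (!D.row s) m q := by
      refine .of_fitsAt (hFm.mono hpm.le le_rfl) (hq.mono hpm.le le_rfl) ?_ ?_
      · intro j hj _
        have := h1 j hj
        revert this
        cases D.row j <;> cases D.row s <;> simp
      · intro j hj _
        rw [hUq j s' hj hs', ← hss]
        simp
    refine ((hO1.arrangeable hpm).glue hpm.le hmq.le hUm (hO2.arrangeable hmq)).mono ?_
    omega
  · have hO : ∃ ρ, D.Oriented ρ p q := by
      by_cases hl : ∃ s, D.Straddles p s ∧ D.r s < q
      · obtain ⟨s, h1, h2⟩ := hl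
        refine ⟨D.row s, .of_fitsAt hp hq ?_ ?_⟩
        · intro j hj _
          rw [hUp j s hj h1]
        · intro j hj hj' h
          exact hs ⟨s, j, h1, h2, hj, hj', h.symm⟩
      · by_cases hr : ∃ s, D.Straddles q s
        · obtain ⟨s, h1⟩ := hr
          refine ⟨!D.row s, .of_fitsAt hp hq ?_ ?_⟩
          · intro j hj hj'
            exact (hl ⟨j, hj, hj'⟩).elim
          · intro j hj _
            rw [hUq j s hj h1]
            simp
        · refine ⟨true, .of_fitsAt hp hq ?_ ?_⟩
          · intro j hj hj'
            exact (hl ⟨j, hj, hj'⟩).elim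
          · intro j hj _
            exact (hr ⟨j, hj⟩).elim
    obtain ⟨ρ, hO⟩ := hO
    refine (hO.arrangeable hpq).mono ?_
    omega

open Classical in
/-- The heights of the items that meet `[p, q]` and do not lie in row `σ`. -/
noncomputable def oppositeHeights (D : TwoRows ι) (σ : Bool) (p q : ℤ) : Finset ℝ :=
  (Finset.univ.filter fun i => D.Meets p q i ∧ D.row i ≠ σ).image D.h

/-- If the item overlapping the left border does not fit, one can cut at the left end of the
leftmost of the highest items in the other row. -/
theorem exists_cut {p q : ℤ} {t : ι} (ht : D.Straddles p t) (hU : D.UniqueAt p)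
    (hp : ¬ D.FitsAt p p q) :
    ∃ m, p < m ∧ m < q ∧ D.UniqueAt m ∧ D.FitsAt m p q ∧
      (D.oppositeHeights (D.row t) p m).card < (D.oppositeHeights (D.row t) p q).card := by
  classical
  unfold FitsAt at hp
  push Not at hp
  obtain ⟨t', ht', i, hi, hir, hih⟩ := hp
  obtain rfl := hU t t' ht ht'
  obtain ⟨u, hu, humax⟩ := Finset.exists_max_image
    (Finset.univ.filter fun i => D.Meets p q i ∧ D.row i ≠ D.row t) D.h ⟨i, by simp [hi, hir]⟩
  obtain ⟨g, hg, hgmin⟩ := Finset.exists_min_image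
    (Finset.univ.filter fun i => (D.Meets p q i ∧ D.row i ≠ D.row t) ∧ D.h i = D.h u) D.l
    ⟨u, by simpa using hu⟩
  simp only [Finset.mem_filter, Finset.mem_univ, true_and] at hu humax hg hgmin
  -- `g` is at least as high as the misfit `i`, so it conflicts with `t`; as `t` crosses `p`, `g`
  -- must lie to the right of `t`.
  have hpg : p < D.l g := by
    have h1 := humax i ⟨hi, hir⟩
    have h2 : D.H < D.h g + D.h t := by linarith [hg.2]
    have := D.sep g t (fun h => hg.1.2 (by rw [h])) (Or.inr h2)
    unfold Straddles at ht
    unfold Meets at hg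
    omega
  obtain ⟨-, hUm, hFm⟩ := cut_at_highest (p := p) (q := q) (Or.inl (rfl : D.l g = D.l g))
    (fun i hi hr => by rw [hg.2]; exact humax i ⟨hi, hr ▸ hg.1.2⟩)
  refine ⟨D.l g, hpg, hg.1.1.1, hUm, hFm, Finset.card_lt_card ?_⟩
  have hgq := hg.1.1.1
  rw [Finset.ssubset_iff_of_subset]
  -- The height of `g` disappears: an item of that height meeting `[p, D.l g]` would begin to the
  -- left of the leftmost one.
  · refine ⟨D.h g, Finset.mem_image_of_mem _ (by simpa using hg.1), ?_⟩
    intro h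
    obtain ⟨k, hk, hkh⟩ := Finset.mem_image.1 h
    simp only [Finset.mem_filter, Finset.mem_univ, true_and] at hk
    exact absurd hk.1.1 (not_lt.2 (hgmin k ⟨⟨⟨hk.1.1.trans hgq, hk.1.2⟩, hk.2⟩, hkh.trans hg.2⟩))
  · apply Finset.image_subset_image
    intro k hk
    simp only [Finset.mem_filter, Finset.mem_univ, true_and] at hk ⊢
    exact ⟨⟨hk.1.1.trans hgq, hk.1.2⟩, hk.2⟩

-- Induction on the number of heights opposite to the item crossing `p`. Each cut splits off a right
-- part with two fitting borders, costing `2K + 1` slots (`K` the number of attributes) and one for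
-- the item crossing the cut.
open Classical in
theorem arrangeable_of_fitsAt_right {p q : ℤ} (hpq : p < q) (hUp : D.UniqueAt p)
    (hUq : D.UniqueAt q) (hq : D.FitsAt q p q) :
    D.Arrangeable p q (((Finset.univ.image D.h).card + 1) *
      (2 * (Finset.univ.image D.attr).card + 2)) := by
  by_cases ht : ∃ t, D.Straddles p t
  · obtain ⟨t, ht⟩ := ht
    have key : ∀ n : ℕ, ∀ q, p < q → D.UniqueAt q → D.FitsAt q p q →
        (D.oppositeHeights (D.row t) p q).card ≤ n →
        D.Arrangeable p q ((n + 1) * (2 * (Finset.univ.image D.attr).card + 2)) := by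
      intro n
      induction n with
      | zero =>
        intro q hpq hUq hq hn
        by_cases hp : D.FitsAt p p q
        · exact (arrangeable_of_fitsAt hpq hUp hUq hp hq).mono (by omega)
        · obtain ⟨m, -, -, -, -, h⟩ := exists_cut ht hUp hp
          omega
      | succ n ih =>
        intro q hpq hUq hq hn
        by_cases hp : D.FitsAt p p q
        · refine (arrangeable_of_fitsAt hpq hUp hUq hp hq).mono ?_
          rw [add_mul]
          omega
        · obtain ⟨m, hpm, hmq, hUm, hFm, h⟩ := exists_cut ht hUp hp
          refine ((ih m hpm hUm (hFm.mono le_rfl hmq.le) (by omega)).glue hpm.le hmq.le hUm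
            (arrangeable_of_fitsAt hmq hUm hUq (hFm.mono hpm.le le_rfl)
              (hq.mono hpm.le le_rfl))).mono ?_
          rw [add_mul (n + 1)]
          omega
    exact key _ q hpq hUq hq (Finset.card_le_card
      (Finset.image_subset_image (Finset.filter_subset _ _)))
  · refine (arrangeable_of_fitsAt hpq hUp hUq (fun j hj => (ht ⟨j, hj⟩).elim) hq).mono ?_
    rw [add_mul]
    omega

end TwoRows
end StripPacking

/-! ### Reflection, and intervals with arbitrary borders -/

namespace StripPacking
namespace TwoRows

variable {ι : Type*} (D : TwoRows ι)

/-- The reflection at the line `x = 0`. -/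
def mirror : TwoRows ι where
  row := D.row
  tall := D.tall
  l i := - D.r i
  r i := - D.l i
  h := D.h
  H := D.H
  lt i := neg_lt_neg (D.lt i)
  sep i j hij hc := by
    have := D.sep i j hij hc
    omega

variable {D}

theorem mirror_straddles {m : ℤ} {i : ι} : D.mirror.Straddles (-m) i ↔ D.Straddles m i := by
  simp only [Straddles, mirror]
  omega

theorem mirror_meets {p q : ℤ} {i : ι} : D.mirror.Meets (-q) (-p) i ↔ D.Meets p q i := by
  simp only [Meets, mirror]
  omega

theorem mirror_inner {p q : ℤ} {i : ι} : D.mirror.Inner (-q) (-p) i ↔ D.Inner p q i := by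
  simp only [Inner, mirror]
  omega

theorem mirror_w (i : ι) : D.mirror.w i = D.w i := by
  simp only [w, mirror]
  omega

theorem UniqueAt.mirror {m : ℤ} (h : D.UniqueAt m) : D.mirror.UniqueAt (-m) :=
  fun i j hi hj => h i j (mirror_straddles.1 hi) (mirror_straddles.1 hj)

theorem FitsAt.mirror {m p q : ℤ} (h : D.FitsAt m p q) : D.mirror.FitsAt (-m) (-q) (-p) :=
  fun j hj i hi hr => h j (mirror_straddles.1 hj) i (mirror_meets.1 hi) hr

theorem Arrangeable.of_mirror {p q : ℤ} {n : ℕ} (h : D.mirror.Arrangeable (-q) (-p) n) :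
    D.Arrangeable p q n := by
  classical
  obtain ⟨ξ, σ, G, A, hG⟩ := h
  set f : Slot → Slot := fun g => ⟨g.attr, -g.right, -g.left⟩ with hf
  refine ⟨fun i => - (ξ i + D.w i), fun i => f (σ i), G.image f,
    ⟨?_, ?_, ?_, ?_, ?_⟩, Finset.card_image_le.trans hG⟩
  · intro i hi
    have := A.outer i (mt mirror_inner.1 hi)
    simp only [this, mirror, w]
    omega
  · intro i hi
    have := A.inner i (mirror_inner.2 hi)
    rw [mirror_w] at this
    omega
  · intro i j hij hc
    have := A.sep i j hij hc
    rw [mirror_w, mirror_w] at this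
    omega
  · intro i hi
    obtain ⟨hg, h1, h2⟩ := A.cover i (mirror_inner.2 hi)
    rw [mirror_w] at h2
    refine ⟨Finset.mem_image_of_mem _ hg, h1, ?_⟩
    simp only [hf]
    omega
  · intro g hg
    obtain ⟨g, hg', rfl⟩ := Finset.mem_image.1 hg
    obtain ⟨h1, h2⟩ := A.fill g hg'
    refine ⟨neg_lt_neg h1, fun x hx hx' => ?_⟩
    simp only [hf] at hx hx'
    -- Reflection takes the unit cell starting at `x` to the one starting at `-x - 1`.
    obtain ⟨i, hi, h3, h4⟩ := h2 (-x - 1) (by omega) (by omega)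
    rw [mirror_w] at h4
    refine ⟨i, mirror_inner.1 hi, by rw [h3], ?_⟩
    omega

variable [Fintype ι]

open Classical in
theorem arrangeable_of_fitsAt_left {p q : ℤ} (hpq : p < q) (hUp : D.UniqueAt p)
    (hUq : D.UniqueAt q) (hp : D.FitsAt p p q) :
    D.Arrangeable p q (((Finset.univ.image D.h).card + 1) *
      (2 * (Finset.univ.image D.attr).card + 2)) :=
  .of_mirror (arrangeable_of_fitsAt_right (neg_lt_neg hpq) hUq.mirror hUp.mirror hp.mirror)

-- If the left border does not fit, the line `m` of `exists_cut` does, so each of the two parts has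
-- a fitting border at `m`.
open Classical in
theorem arrangeable {p q : ℤ} (hpq : p < q) (hUp : D.UniqueAt p) (hUq : D.UniqueAt q) :
    D.Arrangeable p q (2 * (((Finset.univ.image D.h).card + 1) *
      (2 * (Finset.univ.image D.attr).card + 2)) + 1) := by
  by_cases hp : D.FitsAt p p q
  · exact (arrangeable_of_fitsAt_left hpq hUp hUq hp).mono (by omega)
  · have ht : ∃ t, D.Straddles p t := by
      by_contra h
      exact hp fun j hj => (h ⟨j, hj⟩).elim
    obtain ⟨t, ht⟩ := ht
    obtain ⟨m, hpm, hmq, hUm, hFm, -⟩ := exists_cut ht hUp hp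
    refine ((arrangeable_of_fitsAt_right hpm hUp hUm (hFm.mono le_rfl hmq.le)).glue hpm.le hmq.le
      hUm (arrangeable_of_fitsAt_left hmq hUm hUq (hFm.mono hpm.le le_rfl))).mono ?_
    omega

open Classical in
/-- The rearrangement of all items meeting `[p, q]`, including those that cross its borders. -/
theorem exists_placement {p q : ℤ} (hpq : p < q) (hUp : D.UniqueAt p) (hUq : D.UniqueAt q)
    (hmeet : ∀ i, D.Meets p q i) :
    ∃ (ξ : ι → ℤ) (σ : ι → Slot) (G : Finset Slot),
      G.card ≤ 2 * (((Finset.univ.image D.h).card + 1) *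
        (2 * (Finset.univ.image D.attr).card + 2)) + 3 ∧
      (∀ i, ¬ D.Inner p q i → ξ i = D.l i) ∧
      (∀ i, D.Inner p q i → p ≤ ξ i ∧ ξ i + D.w i ≤ q) ∧
      (∀ i j, i ≠ j → (D.row i = D.row j ∨ D.H < D.h i + D.h j) →
        ξ i + D.w i ≤ ξ j ∨ ξ j + D.w j ≤ ξ i) ∧
      (∀ i, σ i ∈ G ∧ (σ i).attr = D.attr i ∧ (σ i).left ≤ max (ξ i) p ∧
        min (ξ i + D.w i) q ≤ (σ i).right) ∧
      (∀ g ∈ G, p ≤ g.left ∧ g.left < g.right ∧ g.right ≤ q ∧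
        ∀ x, g.left ≤ x → x < g.right → ∃ i, σ i = g ∧ ξ i ≤ x ∧ x < ξ i + D.w i) := by
  obtain ⟨ξ, σ, G, A, hG⟩ := D.arrangeable hpq hUp hUq
  -- Border-crossing items keep their place and get a slot clipped to `[p, q]`; by uniqueness this
  -- adds at most two slots.
  set c : ι → Slot := fun i => ⟨D.attr i, max (D.l i) p, min (D.r i) q⟩ with hc
  have hcard : ∀ m, D.UniqueAt m →
      ((Finset.univ.filter fun i => D.Straddles m i).image c).card ≤ 1 := by
    intro m hm
    refine Finset.card_image_le.trans (Finset.card_le_one.2 ?_)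
    intro i hi j hj
    exact hm i j (by simpa using hi) (by simpa using hj)
  have hw : ∀ i, D.l i + D.w i = D.r i := fun i => by unfold w; omega
  have hnot : ∀ i, D.Straddles p i ∨ D.Straddles q i ↔ ¬ D.Inner p q i := by
    intro i
    have := hmeet i
    unfold Meets at this
    unfold Straddles Inner
    omega
  refine ⟨ξ, fun i => if D.Inner p q i then σ i else c i, G ∪ (Finset.univ.filter fun i => D.Straddles p i).image c ∪
    (Finset.univ.filter fun i => D.Straddles q i).image c, ?_, A.outer, A.inner, A.sep, ?_, ?_⟩
  · refine (Finset.card_union_le _ _).trans ?_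
    have := Finset.card_union_le G ((Finset.univ.filter fun i => D.Straddles p i).image c)
    have := hcard p hUp
    have := hcard q hUq
    omega
  · intro i
    dsimp only
    by_cases hi : D.Inner p q i
    · obtain ⟨hg, h1, h2⟩ := A.cover i hi
      rw [if_pos hi]
      exact ⟨by simp [hg], h1, by omega⟩
    · rw [if_neg hi]
      refine ⟨?_, rfl, ?_⟩
      · rcases (hnot i).2 hi with h | h
        · exact Finset.mem_union_left _ (Finset.mem_union_right _
            (Finset.mem_image_of_mem _ (by simpa using h)))
        · exact Finset.mem_union_right _ (Finset.mem_image_of_mem _ (by simpa using h))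
      · rw [A.outer i hi, hw]
        exact ⟨le_rfl, le_rfl⟩
  · intro g hg
    have hg : g ∈ G ∨ ∃ i, ¬ D.Inner p q i ∧ c i = g := by
      simp only [Finset.mem_union, Finset.mem_image, Finset.mem_filter, Finset.mem_univ,
        true_and] at hg
      rcases hg with (hg | ⟨i, hi, h⟩) | ⟨i, hi, h⟩
      · exact Or.inl hg
      · exact Or.inr ⟨i, (hnot i).1 (Or.inl hi), h⟩
      · exact Or.inr ⟨i, (hnot i).1 (Or.inr hi), h⟩
    rcases hg with hg | ⟨i, hi, rfl⟩
    · obtain ⟨h1, h2⟩ := A.fill g hg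
      obtain ⟨i, hi, -, h3⟩ := h2 g.left le_rfl h1
      obtain ⟨j, hj, -, h4⟩ := h2 (g.right - 1) (by omega) (by omega)
      have := A.inner i hi
      have := A.inner j hj
      refine ⟨by omega, h1, by omega, fun x hx hx' => ?_⟩
      obtain ⟨k, hk, hk'⟩ := h2 x hx hx'
      exact ⟨k, by dsimp only; rwa [if_pos hk]⟩
    · have hm := hmeet i
      have := D.lt i
      unfold Meets at hm
      simp only [hc]
      refine ⟨by omega, by omega, by omega, fun x hx hx' => ⟨i, if_neg hi, ?_⟩⟩
      rw [A.outer i hi, hw]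
      omega

end TwoRows
end StripPacking

/-! ### Geometry of tall and pseudo items in the box -/

namespace StripPacking

theorem breakpoints_finite (B : Rect) (T : Finset Rect) : (breakpoints B T).Finite := by
  classical
  refine Set.Finite.subset (s := ↑(({B.x, B.x + B.w} : Finset ℝ) ∪ T.image (fun t => t.x) ∪
    T.image (fun t => t.x + t.w))) (Finset.finite_toSet _) ?_
  rintro c (rfl | rfl | ⟨-, -, t, ht, rfl | rfl⟩)
  · simp
  · simp
  · simp only [Finset.coe_union, Finset.coe_image]
    exact Or.inl (Or.inr ⟨t, ht, rfl⟩)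
  · simp only [Finset.coe_union, Finset.coe_image]
    exact Or.inr ⟨t, ht, rfl⟩

theorem IsStrip.eq_of_lt {B : Rect} {T : Finset Rect} {a b a' b' : ℝ} (h : IsStrip B T a b)
    (h' : IsStrip B T a' b') (h1 : a < b') (h2 : a' < b) : a = a' ∧ b = b' := by
  obtain ⟨ha, hb, hab, hc⟩ := h
  obtain ⟨ha', hb', hab', hc'⟩ := h'
  constructor
  · rcases lt_trichotomy a a' with h | h | h
    · exact (hc a' ha' ⟨h, h2⟩).elim
    · exact h
    · exact (hc' a ha ⟨h, h1⟩).elim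
  · rcases lt_trichotomy b b' with h | h | h
    · exact (hc' b hb ⟨h2, h⟩).elim
    · exact h
    · exact (hc b' hb' ⟨h1, h⟩).elim

theorem IsPseudo.isStrip {B : Rect} {T : Finset Rect} {p : Rect} (hp : IsPseudo B T p) :
    IsStrip B T p.x (p.x + p.w) := by
  rcases hp with ⟨a, b, hs⟩ | ⟨a, b, hs⟩ | ⟨a, b, hs⟩ <;> simpa using hs

/-- A pseudo item is determined by two breakpoints, a lower border and a height, each from a finite
set. -/
theorem pseudoItems_finite (B : Rect) (T : Finset Rect) : (pseudoItems B T).Finite := by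
  classical
  have hb := breakpoints_finite B T
  have hf : ((fun z : (ℝ × ℝ) × ℝ × ℝ => (⟨z.1.1, z.2.1, z.1.2 - z.1.1, z.2.2⟩ : Rect)) ''
      ((breakpoints B T ×ˢ breakpoints B T) ×ˢ
        (insert B.y ((fun t : Rect => B.y + t.h) '' (T : Set Rect)) ×ˢ
          insert B.h ((fun t : Rect => B.h - t.h) '' (T : Set Rect))))).Finite :=
    ((hb.prod hb).prod (((T.finite_toSet.image _).insert _).prod
      ((T.finite_toSet.image _).insert _))).image _
  refine hf.subset ?_
  rintro p (⟨a, b, hs, hno⟩ | ⟨a, b, hs, t, ht, -⟩ | ⟨a, b, hs, t, ht, -⟩)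
  · exact ⟨((a, b), B.y, B.h), ⟨⟨hs.1, hs.2.1⟩, Or.inl rfl, Or.inl rfl⟩, rfl⟩
  · exact ⟨((a, b), B.y + t.h, B.h - t.h),
      ⟨⟨hs.1, hs.2.1⟩, Or.inr ⟨t, ht, rfl⟩, Or.inr ⟨t, ht, rfl⟩⟩, rfl⟩
  · exact ⟨((a, b), B.y, B.h - t.h),
      ⟨⟨hs.1, hs.2.1⟩, Or.inl rfl, Or.inr ⟨t, ht, rfl⟩⟩, rfl⟩

/-- Two rectangles with the same vertical extent as items at the bottom or the top of `B` meet
vertically if and only if they lie in the same row or are together higher than `B`. -/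
theorem vertical_meet_iff {B r s : Rect} (hr : 0 < r.h) (hs : 0 < s.h) (hrB : r.h ≤ B.h)
    (hr' : r.y = B.y ∨ r.y + r.h = B.y + B.h)
    (hs' : s.y = B.y ∨ s.y + s.h = B.y + B.h) :
    (r.y < s.y + s.h ∧ s.y < r.y + r.h) ↔
      ((r.y = B.y ↔ s.y = B.y) ∨ B.h < r.h + s.h) := by
  by_cases h1 : r.y = B.y <;> by_cases h2 : s.y = B.y
  · simp only [h1, h2]
    simp [hr, hs]
  · have := hs'.resolve_left h2
    simp only [h1, h2, iff_false, not_true, false_or]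
    constructor
    · rintro ⟨h3, h4⟩
      linarith
    · intro h
      constructor <;> linarith
  · have := hr'.resolve_left h1
    simp only [h1, h2, iff_true, false_or]
    constructor
    · rintro ⟨h3, h4⟩
      linarith
    · intro h
      constructor <;> linarith
  · have := hs'.resolve_left h2
    have := hr'.resolve_left h1
    simp only [h1, h2, iff_self, true_or, iff_true]
    constructor <;> linarith

namespace IsLargeBox

variable {ε OPT : ℝ} {B : Rect} {T V : Finset Rect}

theorem height_pos (hB : IsLargeBox ε OPT B T V) (hε : 0 < ε) (hO : 0 < OPT) : 0 < B.h := by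
  have := hB.box_height
  have : 0 < (2 / 3 + 2 * ε) * OPT := by positivity
  linarith

theorem breakpoint_int (hB : IsLargeBox ε OPT B T V) {c : ℝ} (hc : c ∈ breakpoints B T) :
    ∃ a : ℤ, c = a := by
  rcases hc with rfl | rfl | ⟨-, -, t, ht, rfl | rfl⟩
  · exact hB.box_grid.1
  · obtain ⟨⟨a, ha⟩, b, hb⟩ := hB.box_grid
    exact ⟨a + b, by rw [ha, hb]; push_cast; rfl⟩
  · exact (hB.tall_grid t ht).1
  · obtain ⟨⟨a, ha⟩, b, hb⟩ := hB.tall_grid t ht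
    exact ⟨a + b, by rw [ha, hb]; push_cast; rfl⟩

theorem breakpoint_mem (hB : IsLargeBox ε OPT B T V) {c : ℝ} (hc : c ∈ breakpoints B T) :
    B.x ≤ c ∧ c ≤ B.x + B.w := by
  have := hB.box_width
  rcases hc with rfl | rfl | ⟨h1, h2, -⟩
  · exact ⟨le_rfl, by linarith⟩
  · exact ⟨by linarith, le_rfl⟩
  · exact ⟨h1.le, h2.le⟩

theorem pseudo_pos (hB : IsLargeBox ε OPT B T V) (hε : 0 < ε) (hO : 0 < OPT) {p : Rect}
    (hp : IsPseudo B T p) : p.Pos := by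
  have hH := hB.height_pos hε hO
  rcases hp with ⟨a, b, hs, -⟩ | ⟨a, b, hs, t, -, -, -, -, hh⟩ | ⟨a, b, hs, t, -, -, -, -, hh⟩
  · exact ⟨sub_pos.2 hs.2.2.1, hH⟩
  · exact ⟨sub_pos.2 hs.2.2.1, sub_pos.2 hh⟩
  · exact ⟨sub_pos.2 hs.2.2.1, sub_pos.2 hh⟩

theorem pseudo_inside (hB : IsLargeBox ε OPT B T V) {p : Rect} (hp : IsPseudo B T p) :
    p.Inside B := by
  have hs := hp.isStrip
  refine ⟨(hB.breakpoint_mem hs.1).1, (hB.breakpoint_mem hs.2.1).2, ?_⟩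
  rcases hp with ⟨a, b, hs, -⟩ | ⟨a, b, hs, t, ht, -⟩ | ⟨a, b, hs, t, ht, -⟩
  · exact ⟨le_rfl, le_rfl⟩
  · have := (hB.tall_pos t ht).2
    dsimp only
    constructor <;> linarith
  · have := (hB.tall_pos t ht).2
    dsimp only
    constructor <;> linarith

theorem item_pos (hB : IsLargeBox ε OPT B T V) (hε : 0 < ε) (hO : 0 < OPT) {r : Rect}
    (hr : r ∈ (T : Set Rect) ∪ pseudoItems B T) : r.Pos := by
  rcases hr with hr | hr
  · exact hB.tall_pos r hr
  · exact hB.pseudo_pos hε hO hr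

theorem item_int (hB : IsLargeBox ε OPT B T V) {r : Rect}
    (hr : r ∈ (T : Set Rect) ∪ pseudoItems B T) : ∃ a b : ℤ, r.x = a ∧ r.x + r.w = b := by
  rcases hr with hr | hr
  · obtain ⟨⟨a, ha⟩, b, hb⟩ := hB.tall_grid r hr
    exact ⟨a, a + b, ha, by rw [ha, hb]; push_cast; rfl⟩
  · have hs := IsPseudo.isStrip hr
    obtain ⟨a, ha⟩ := hB.breakpoint_int hs.1
    obtain ⟨b, hb⟩ := hB.breakpoint_int hs.2.1
    exact ⟨a, b, ha, hb⟩

theorem item_within (hB : IsLargeBox ε OPT B T V) {r : Rect}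
    (hr : r ∈ (T : Set Rect) ∪ pseudoItems B T) : B.y ≤ r.y ∧ r.y + r.h ≤ B.y + B.h := by
  rcases hr with hr | hr
  · exact hB.tall_within r hr
  · exact (hB.pseudo_inside hr).2.2

theorem item_touches (hB : IsLargeBox ε OPT B T V) {r : Rect}
    (hr : r ∈ (T : Set Rect) ∪ pseudoItems B T) : r.y = B.y ∨ r.y + r.h = B.y + B.h := by
  rcases hr with hr | hr
  · exact hB.tall_touches r hr
  · rcases hr with ⟨a, b, hs, -⟩ | ⟨a, b, hs, t, -⟩ | ⟨a, b, hs, t, -⟩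
    · exact Or.inl rfl
    · right
      dsimp only
      ring
    · exact Or.inl rfl

theorem item_meets (hB : IsLargeBox ε OPT B T V) {r : Rect}
    (hr : r ∈ (T : Set Rect) ∪ pseudoItems B T) : r.x < B.x + B.w ∧ B.x < r.x + r.w := by
  rcases hr with hr | hr
  · have := hB.tall_meets r hr
    exact ⟨this.1, this.2.1⟩
  · have hs := IsPseudo.isStrip hr
    have h1 := hB.breakpoint_mem hs.1
    have h2 := hB.breakpoint_mem hs.2.1
    have := hs.2.2.1
    constructor <;> linarith

theorem pseudo_not_crosses (hB : IsLargeBox ε OPT B T V) {p : Rect} (hp : IsPseudo B T p) :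
    ¬ (p.CrossesLeft B ∨ p.CrossesRight B) := by
  have h := hB.pseudo_inside hp
  rintro (h' | h')
  · exact absurd h.1 (not_le.2 h'.1)
  · exact absurd h.2.1 (not_le.2 h'.2)

theorem not_overlaps_tall_pseudo {s p : Rect} (hs : s ∈ T)
    (hp : IsPseudo B T p) : ¬ s.Overlaps p := by
  rintro ⟨h1, h2, h3, h4⟩
  rcases hp with ⟨a, b, hst, hno⟩ | ⟨a, b, hst, t, ht, hm, hu, hb, hh⟩ |
    ⟨a, b, hst, t, ht, hm, hu, hb, hh⟩
  · simp only [add_sub_cancel] at h1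
    exact hno s hs ⟨h1, h2⟩
  · simp only [add_sub_cancel] at h1
    obtain rfl := hu s hs ⟨h1, h2⟩
    unfold Rect.TouchesBottom at hb
    dsimp only at h4
    linarith
  · simp only [add_sub_cancel] at h1
    obtain rfl := hu s hs ⟨h1, h2⟩
    unfold Rect.TouchesTop at hb
    dsimp only at h3
    linarith

theorem pseudo_notMem (hB : IsLargeBox ε OPT B T V) {p : Rect} (hp : IsPseudo B T p) : p ∉ T := by
  intro h
  have hp' := hB.tall_pos p h
  have h1 := hp'.1
  have h2 := hp'.2
  exact not_overlaps_tall_pseudo h hp ⟨by linarith, by linarith, by linarith, by linarith⟩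

/-- Overlapping pseudo items lie over the same strip, and a strip carries at most one. The cases
above and below exclude each other, since a tall item touching both borders has height `B.h` and
yields no pseudo item. -/
theorem pseudo_eq_of_overlaps {p p' : Rect} (hp : IsPseudo B T p)
    (hp' : IsPseudo B T p') (h : p.Overlaps p') : p = p' := by
  obtain ⟨h1, h2⟩ := hp.isStrip.eq_of_lt hp'.isStrip h.1 h.2.1
  clear h
  rcases hp with ⟨a, b, hst, hno⟩ | ⟨a, b, hst, t, ht, hm, hu, hb, hh⟩ |
    ⟨a, b, hst, t, ht, hm, hu, hb, hh⟩ <;>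
  rcases hp' with ⟨a', b', hst', hno'⟩ | ⟨a', b', hst', t', ht', hm', hu', hb', hh'⟩ |
    ⟨a', b', hst', t', ht', hm', hu', hb', hh'⟩ <;>
  simp only [add_sub_cancel] at h1 h2 <;> subst h1 <;> subst h2
  · rfl
  · exact (hno t' ht' hm').elim
  · exact (hno t' ht' hm').elim
  · exact (hno' t ht hm).elim
  · rw [hu t' ht' hm']
  · obtain rfl := hu t' ht' hm'
    unfold Rect.TouchesBottom at hb
    unfold Rect.TouchesTop at hb'
    linarith
  · exact (hno' t ht hm).elim
  · obtain rfl := hu t' ht' hm'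
    unfold Rect.TouchesBottom at hb'
    unfold Rect.TouchesTop at hb
    linarith
  · rw [hu t' ht' hm']

theorem items_nonOverlapping (hB : IsLargeBox ε OPT B T V) :
    NonOverlapping ((T : Set Rect) ∪ pseudoItems B T) := by
  rintro r (hr | hr) s (hs | hs) hrs h
  · exact hB.feasible_tall hr hs hrs h
  · exact not_overlaps_tall_pseudo hr hs h
  · exact not_overlaps_tall_pseudo hs hr ⟨h.2.1, h.1, h.2.2.2, h.2.2.1⟩
  · exact hrs (pseudo_eq_of_overlaps hr hs h)

theorem crossing_left_eq (hB : IsLargeBox ε OPT B T V) {r s : Rect}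
    (hr : r ∈ (T : Set Rect) ∪ pseudoItems B T) (hs : s ∈ (T : Set Rect) ∪ pseudoItems B T)
    (hr' : r.CrossesLeft B) (hs' : s.CrossesLeft B) : r = s := by
  rcases hr with hr | hr
  · rcases hs with hs | hs
    · exact hB.crossing_left r hr s hs hr' hs'
    · exact (hB.pseudo_not_crosses hs (Or.inl hs')).elim
  · exact (hB.pseudo_not_crosses hr (Or.inl hr')).elim

theorem crossing_right_eq (hB : IsLargeBox ε OPT B T V) {r s : Rect}
    (hr : r ∈ (T : Set Rect) ∪ pseudoItems B T) (hs : s ∈ (T : Set Rect) ∪ pseudoItems B T)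
    (hr' : r.CrossesRight B) (hs' : s.CrossesRight B) : r = s := by
  rcases hr with hr | hr
  · rcases hs with hs | hs
    · exact hB.crossing_right r hr s hs hr' hs'
    · exact (hB.pseudo_not_crosses hs (Or.inr hs')).elim
  · exact (hB.pseudo_not_crosses hr (Or.inr hr')).elim

end IsLargeBox

end StripPacking

/-! ### Vertical items travel with pseudo items -/

namespace StripPacking

theorem Rect.Overlaps.of_inside {r s r' s' : Rect} (h : r.Overlaps s) (hr : r.Inside r')
    (hs : s.Inside s') : r'.Overlaps s' := by
  obtain ⟨h1, h2, h3, h4⟩ := h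
  obtain ⟨a1, a2, a3, a4⟩ := hr
  obtain ⟨b1, b2, b3, b4⟩ := hs
  exact ⟨by linarith, by linarith, by linarith, by linarith⟩

theorem Rect.inter_inside_left (r s : Rect) : (r.inter s).Inside r := by
  refine ⟨le_max_left _ _, ?_, le_max_left _ _, ?_⟩
  · simp [Rect.inter]
  · simp [Rect.inter]

theorem Rect.inter_inside_right (r s : Rect) : (r.inter s).Inside s := by
  refine ⟨le_max_right _ _, ?_, le_max_right _ _, ?_⟩
  · simp [Rect.inter]
  · simp [Rect.inter]

theorem Rect.Overlaps.inter_w_pos {r s : Rect} (hr : 0 < r.w) (hs : 0 < s.w) (h : r.Overlaps s) :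
    0 < (r.inter s).w := by
  obtain ⟨h1, h2, -, -⟩ := h
  simp only [Rect.inter, sub_pos, max_lt_iff, lt_min_iff]
  exact ⟨⟨by linarith, h2⟩, h1, by linarith⟩

theorem coveredSlices_finite (B : Rect) (T V : Finset Rect) : (coveredSlices B T V).Finite := by
  refine ((V.finite_toSet.prod (pseudoItems_finite B T)).image
    fun z => Rect.inter z.1 z.2).subset ?_
  rintro r ⟨v, hv, p, hp, -, rfl⟩
  exact ⟨(v, p), ⟨hv, hp⟩, rfl⟩

/-- If every pseudo item moves into one of the boxes in `U`, the vertical items that it covers can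
move along with it. -/
theorem fractionallyPacks_of_move {B : Rect} {T V U : Finset Rect} (ξ : Rect → ℝ)
    (hV : ∀ v ∈ V, v.Pos) (hP : ∀ p ∈ pseudoItems B T, p.Pos)
    (hVV : NonOverlapping (V : Set Rect))
    (hsep : (pseudoItems B T).Pairwise fun r s => ¬ (r.moveTo (ξ r)).Overlaps (s.moveTo (ξ s)))
    (hU : ∀ p ∈ pseudoItems B T, ∃ u ∈ U, (p.moveTo (ξ p)).Inside u) :
    FractionallyPacks (coveredSlices B T V) U := by
  classical
  have := (coveredSlices_finite B T V).fintype
  let e := (Fintype.equivFin (coveredSlices B T V)).symm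
  choose v hv p hp ho he using fun a : coveredSlices B T V => a.2
  -- Each slice is translated by the same amount as the pseudo item containing it.
  have hin : ∀ a : coveredSlices B T V,
      ((a : Rect).moveTo ((a : Rect).x + (ξ (p a) - (p a).x))).Inside
        ((p a).moveTo (ξ (p a))) := by
    intro a
    have := Rect.inter_inside_right (v a) (p a)
    rw [← he a] at this
    obtain ⟨h1, h2, h3, h4⟩ := this
    refine ⟨?_, ?_, h3, h4⟩ <;> simp only [Rect.moveTo] <;> linarith
  refine ⟨_, fun k => e k, fun k => (e k : Rect).moveTo ((e k : Rect).x + (ξ (p (e k)) - (p (e k)).x)),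
    ?_, ?_, ?_⟩
  · intro k
    refine ⟨(e k).2, rfl, ?_, ?_⟩
    · change 0 < (e k : Rect).w
      rw [he (e k)]
      exact (ho (e k)).inter_w_pos (hV _ (hv _)).1 (hP _ (hp _)).1
    · obtain ⟨u, hu, hpu⟩ := hU _ (hp (e k))
      refine ⟨u, hu, ?_⟩
      obtain ⟨h1, h2, h3, h4⟩ := hin (e k)
      obtain ⟨g1, g2, g3, g4⟩ := hpu
      exact ⟨g1.trans h1, h2.trans g2, g3.trans h3, h4.trans g4⟩
  · intro k l hkl h
    -- Slices in one pseudo item keep their relative position, so an overlap would already exist in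
    -- `V`; slices in different ones are separated by the moved pseudo items.
    by_cases hpp : p (e k) = p (e l)
    · have h' : (e k : Rect).Overlaps (e l) := by
        obtain ⟨h1, h2, h3, h4⟩ := h
        simp only [Rect.moveTo, hpp] at h1 h2 h3 h4
        exact ⟨by linarith, by linarith, h3, h4⟩
      have hvv : v (e k) = v (e l) := by
        by_contra hne
        refine hVV (hv _) (hv _) hne (h'.of_inside ?_ ?_)
        · rw [he (e k)]
          exact Rect.inter_inside_left _ _
        · rw [he (e l)]
          exact Rect.inter_inside_left _ _
      apply hkl
      apply e.injective
      apply Subtype.ext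
      rw [he (e k), he (e l), hvv, hpp]
    · exact hsep (hp _) (hp _) hpp (h.of_inside (hin _) (hin _))
  · intro a ha
    have : Finset.univ.filter (fun k => (e k : Rect) = a) = {e.symm ⟨a, ha⟩} := by
      ext k
      simp only [Finset.mem_filter, Finset.mem_univ, true_and, Finset.mem_singleton,
        Equiv.eq_symm_apply]
      exact ⟨fun h => Subtype.ext h, fun h => by rw [h]⟩
    rw [this, Finset.sum_singleton]
    simp [Rect.moveTo]

end StripPacking

/-! ### From slots to subboxes -/

namespace StripPacking

/-- The part of the box `B` that belongs to a slot. -/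
noncomputable def Slot.rect (B : Rect) (g : Slot) : Rect where
  x := g.left
  y := if g.attr.1 then B.y else B.y + B.h - g.attr.2.2
  w := (g.right - g.left : ℤ)
  h := g.attr.2.2

section

variable {ε OPT : ℝ} {B : Rect} {T V : Finset Rect}

-- An item of full height belongs to the bottom row; it conflicts with every other item anyway,
-- since all heights are positive.
open Classical in
theorem IsLargeBox.exists_twoRows (hB : IsLargeBox ε OPT B T V) (hε : 0 < ε) (hO : 0 < OPT) :
    ∃ D : TwoRows ↥((T : Set Rect) ∪ pseudoItems B T),
      (∀ i : ↥((T : Set Rect) ∪ pseudoItems B T), (i : Rect).x = D.l i) ∧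
      (∀ i : ↥((T : Set Rect) ∪ pseudoItems B T), (i : Rect).x + (i : Rect).w = D.r i) ∧
      (∀ i, D.row i = decide ((i : Rect).y = B.y)) ∧ (∀ i, D.tall i = decide ((i : Rect) ∈ T)) ∧
      (∀ i, D.h i = (i : Rect).h) ∧ D.H = B.h := by
  choose l r hl hr using fun i : ↥((T : Set Rect) ∪ pseudoItems B T) => hB.item_int i.2
  refine ⟨⟨fun i => decide ((i : Rect).y = B.y), fun i => decide ((i : Rect) ∈ T), l, r,
    fun i => (i : Rect).h, B.h, ?_, ?_⟩, hl, hr, fun _ => rfl, fun _ => rfl, fun _ => rfl, rfl⟩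
  · intro i
    have := (hB.item_pos hε hO i.2).1
    have h : (l i : ℝ) < r i := by
      rw [← hl, ← hr]
      linarith
    exact_mod_cast h
  · intro i j hij hc
    by_contra hcon
    rw [not_or, not_le, not_le] at hcon
    have hw := hB.item_within i.2
    refine hB.items_nonOverlapping i.2 j.2 (fun h => hij (Subtype.ext h)) ⟨?_, ?_, ?_⟩
    · rw [hl, hr]
      exact_mod_cast hcon.2
    · rw [hl, hr]
      exact_mod_cast hcon.1
    · rw [decide_eq_decide] at hc
      exact (vertical_meet_iff (hB.item_pos hε hO i.2).2 (hB.item_pos hε hO j.2).2 (by linarith)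
        (hB.item_touches i.2) (hB.item_touches j.2)).2 hc

-- The factor 2 counts the rows; kind and height together take at most `S_P + S_T` values.
open Classical in
theorem card_attr_le (D : TwoRows ↥((T : Set Rect) ∪ pseudoItems B T))
    [Fintype ↥((T : Set Rect) ∪ pseudoItems B T)]
    (ht : ∀ i, D.tall i = decide ((i : Rect) ∈ T)) (hh : ∀ i, D.h i = (i : Rect).h) :
    (Finset.univ.image D.attr).card ≤
      2 * (numSizes (pseudoItems B T) + numSizes (T : Set Rect)) := by
  have hP := pseudoItems_finite B T
  have e1 : numSizes (pseudoItems B T) = (hP.toFinset.image Rect.h).card := by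
    rw [numSizes, ← Set.ncard_coe_finset, Finset.coe_image, hP.coe_toFinset]
  have e2 : numSizes (T : Set Rect) = (T.image Rect.h).card := by
    rw [numSizes, ← Set.ncard_coe_finset, Finset.coe_image]
  have hsub : Finset.univ.image D.attr ⊆ (Finset.univ : Finset Bool) ×ˢ
      (({false} ×ˢ hP.toFinset.image Rect.h) ∪ ({true} ×ˢ T.image Rect.h)) := by
    intro α hα
    obtain ⟨i, -, rfl⟩ := Finset.mem_image.1 hα
    simp only [TwoRows.attr, Finset.mem_product, Finset.mem_univ, true_and, Finset.mem_union,
      Finset.mem_singleton, Finset.mem_image, ht, hh, decide_eq_true_eq, decide_eq_false_iff_not]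
    by_cases h : (i : Rect) ∈ T
    · exact Or.inr ⟨h, i, h, rfl⟩
    · exact Or.inl ⟨h, i, hP.mem_toFinset.2 (i.2.resolve_left h), rfl⟩
  refine (Finset.card_le_card hsub).trans ?_
  rw [Finset.card_product, e1, e2]
  have := Finset.card_union_le (({false} : Finset Bool) ×ˢ hP.toFinset.image Rect.h)
    (({true} : Finset Bool) ×ˢ T.image Rect.h)
  simp only [Finset.card_product, Finset.card_singleton, one_mul] at this
  simp only [Finset.card_univ, Fintype.card_bool]
  omega

open Classical in
theorem card_heights_eq (D : TwoRows ↥((T : Set Rect) ∪ pseudoItems B T))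
    [Fintype ↥((T : Set Rect) ∪ pseudoItems B T)] (hh : ∀ i, D.h i = (i : Rect).h) :
    (Finset.univ.image D.h).card = numSizes ((T : Set Rect) ∪ pseudoItems B T) := by
  rw [numSizes, ← Set.ncard_coe_finset, Finset.coe_image]
  congr 1
  ext y
  constructor
  · rintro ⟨i, -, rfl⟩
    exact ⟨i, i.2, (hh i).symm⟩
  · rintro ⟨r, hr, rfl⟩
    exact ⟨⟨r, hr⟩, by simp, hh _⟩

open Classical in
theorem IsLargeBox.exists_slots (hB : IsLargeBox ε OPT B T V) (hε : 0 < ε) (hO : 0 < OPT) :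
    ∃ (ξ : Rect → ℝ) (G : Finset Slot), IsReordering B T ξ ∧
      (∀ g ∈ G, (g.rect B).Pos ∧ (g.rect B).OnGrid ∧ (g.rect B).Inside B) ∧
      (∀ g ∈ G, ∀ g' ∈ G, (g.rect B).Overlaps (g'.rect B) → g = g') ∧
      (∀ g ∈ G, ∀ r ∈ (T : Set Rect) ∪ pseudoItems B T, (r.moveTo (ξ r)).Overlaps (g.rect B) →
        g.attr.2.1 = decide (r ∈ T) ∧ (g.rect B).h = r.h) ∧
      (∀ r ∈ (T : Set Rect) ∪ pseudoItems B T, ∃ g ∈ G, g.attr.2.1 = decide (r ∈ T) ∧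
        (g.rect B).h = r.h ∧ ((r.moveTo (ξ r)).inter B).Inside (g.rect B)) ∧
      G.card ≤ 27 * (numSizes (pseudoItems B T) + numSizes (T : Set Rect)) *
        numSizes ((T : Set Rect) ∪ pseudoItems B T) := by
  have := (T.finite_toSet.union (pseudoItems_finite B T)).fintype
  obtain ⟨D, hl, hr, hrow, htall, hh, hH⟩ := hB.exists_twoRows hε hO
  obtain ⟨p, hp⟩ : ∃ p : ℤ, B.x = p := hB.box_grid.1
  obtain ⟨q, hq⟩ : ∃ q : ℤ, B.x + B.w = q := hB.breakpoint_int (Or.inr (Or.inl rfl))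
  have hpq : p < q := by
    have := hB.box_width
    have h : (p : ℝ) < q := by
      rw [← hp, ← hq]
      linarith
    exact_mod_cast h
  have hw : ∀ i : ↥((T : Set Rect) ∪ pseudoItems B T), (i : Rect).w = D.w i := by
    intro i
    unfold TwoRows.w
    push_cast
    rw [← hl, ← hr]
    ring
  have hstrp : ∀ i, D.Straddles p i ↔ (i : Rect).CrossesLeft B := by
    intro i
    unfold TwoRows.Straddles Rect.CrossesLeft
    rw [hr, hl, hp]
    norm_cast
  have hstrq : ∀ i, D.Straddles q i ↔ (i : Rect).CrossesRight B := by
    intro i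
    unfold TwoRows.Straddles Rect.CrossesRight
    rw [hr, hl, hq]
    norm_cast
  have hmeet : ∀ i, D.Meets p q i := by
    intro i
    have := hB.item_meets i.2
    rw [hr, hl, hq, hp] at this
    exact ⟨by exact_mod_cast this.1, by exact_mod_cast this.2⟩
  have hinner : ∀ i : ↥((T : Set Rect) ∪ pseudoItems B T),
      ¬ ((i : Rect).CrossesLeft B ∨ (i : Rect).CrossesRight B) ↔ D.Inner p q i := by
    intro i
    rw [← hstrp, ← hstrq]
    have := hmeet i
    unfold TwoRows.Meets at this
    unfold TwoRows.Straddles TwoRows.Inner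
    omega
  obtain ⟨ξ, σ, G, hG, hout, hin, hsep, hcov, hfill⟩ := D.exists_placement hpq
    (fun i j hi hj => Subtype.ext (hB.crossing_left_eq i.2 j.2 ((hstrp i).1 hi) ((hstrp j).1 hj)))
    (fun i j hi hj => Subtype.ext (hB.crossing_right_eq i.2 j.2 ((hstrq i).1 hi) ((hstrq j).1 hj)))
    hmeet
  -- The value 0 is arbitrary: only rectangles in `T ∪ P` are ever moved.
  set Ξ : Rect → ℝ := fun r => if h : r ∈ (T : Set Rect) ∪ pseudoItems B T then ξ ⟨r, h⟩ else 0
    with hΞdef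
  have hΞ : ∀ i : ↥((T : Set Rect) ∪ pseudoItems B T), Ξ i = ξ i := by
    intro i
    simp only [hΞdef]
    rw [dif_pos i.2]
  -- items that meet vertically keep apart horizontally
  have hclash : ∀ i j : ↥((T : Set Rect) ∪ pseudoItems B T),
      (i : Rect).y < (j : Rect).y + (j : Rect).h → (j : Rect).y < (i : Rect).y + (i : Rect).h →
      ∀ x, ξ i < x → x ≤ ξ i + D.w i → ξ j < x → x ≤ ξ j + D.w j → i = j := by
    intro i j h1 h2 x hx1 hx2 hx3 hx4
    by_contra hij
    have hwi := hB.item_within i.2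
    have := hsep i j hij (by
      rw [hrow, hrow, decide_eq_decide, hh, hh, hH]
      exact (vertical_meet_iff (hB.item_pos hε hO i.2).2 (hB.item_pos hε hO j.2).2 (by linarith)
        (hB.item_touches i.2) (hB.item_touches j.2)).1 ⟨h1, h2⟩)
    omega
  have hrect : ∀ i, ∀ g : Slot, g.attr = D.attr i →
      (g.rect B).y = (i : Rect).y ∧ (g.rect B).h = (i : Rect).h := by
    intro i g hg
    simp only [Slot.rect, hg, TwoRows.attr, hrow, hh, decide_eq_true_eq, and_true]
    split_ifs with h
    · exact h.symm
    · have := (hB.item_touches i.2).resolve_left h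
      linarith
  have hex : ∀ g ∈ G, ∀ x, g.left ≤ x → x < g.right →
      ∃ i, σ i = g ∧ ξ i ≤ x ∧ x < ξ i + D.w i ∧ g.attr = D.attr i ∧
        (g.rect B).y = (i : Rect).y ∧ (g.rect B).h = (i : Rect).h := by
    intro g hg x hx hx'
    obtain ⟨i, rfl, h1, h2⟩ := (hfill g hg).2.2.2 x hx hx'
    exact ⟨i, rfl, h1, h2, (hcov i).2.1, hrect i _ (hcov i).2.1⟩
  have hrx : ∀ g : Slot, (g.rect B).x + (g.rect B).w = g.right := by
    intro g
    simp [Slot.rect]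
  have hlx : ∀ g : Slot, (g.rect B).x = g.left := fun _ => rfl
  have hslots : ∀ g ∈ G, ∀ g' ∈ G, (g.rect B).Overlaps (g'.rect B) → g = g' := by
    rintro g hg g' hg' ⟨h1, h2, h3, h4⟩
    rw [hlx, hrx] at h1 h2
    have h1 : g.left < g'.right := by exact_mod_cast h1
    have h2 : g'.left < g.right := by exact_mod_cast h2
    have a1 := (hfill g hg).2.1
    have a2 := (hfill g' hg').2.1
    -- Overlapping slots share the unit cell at the larger left end, and both have an item there.
    -- These items meet, hence coincide, and an item has only one slot. `hclash` expects the right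
    -- end of the cell, hence the `+ 1` below.
    obtain ⟨i, hi, b1, b2, -, by1, bh1⟩ := hex g hg (max g.left g'.left) (by omega) (by omega)
    obtain ⟨j, hj, c1, c2, -, cy1, ch1⟩ := hex g' hg' (max g.left g'.left) (by omega) (by omega)
    rw [by1, cy1, ch1] at h3
    rw [by1, bh1, cy1] at h4
    have := hclash i j h3 h4 (max g.left g'.left + 1) (by omega) (by omega) (by omega) (by omega)
    rw [← hi, ← hj, this]
  have hitem : ∀ g ∈ G, ∀ i : ↥((T : Set Rect) ∪ pseudoItems B T),
      ((i : Rect).moveTo (Ξ i)).Overlaps (g.rect B) → g.attr = D.attr i := by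
    rintro g hg i ⟨h1, h2, h3, h4⟩
    simp only [Rect.moveTo] at h3 h4
    rw [hrx] at h1
    have h1 : ξ i < g.right := by
      simp only [Rect.moveTo, hΞ] at h1
      exact_mod_cast h1
    have h2 : g.left < ξ i + D.w i := by
      simp only [Rect.moveTo, hΞ, hw, Slot.rect] at h2
      exact_mod_cast h2
    have a1 := (hfill g hg).2.1
    have a2 := TwoRows.w_pos (D := D) i
    obtain ⟨j, hj, c1, c2, c3, cy1, ch1⟩ := hex g hg (max g.left (ξ i)) (by omega) (by omega)
    rw [cy1, ch1] at h3
    rw [cy1] at h4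
    have := hclash i j h3 h4 (max g.left (ξ i) + 1) (by omega) (by omega) (by omega) (by omega)
    rw [c3, this]
  have hpos : ∀ g ∈ G, (g.rect B).Pos ∧ (g.rect B).OnGrid ∧ (g.rect B).Inside B := by
    intro g hg
    obtain ⟨h1, h2, h3, -⟩ := hfill g hg
    obtain ⟨i, -, -, -, -, hy, hh'⟩ := hex g hg g.left le_rfl h2
    have := (hB.item_pos hε hO i.2).2
    have := hB.item_within i.2
    refine ⟨⟨?_, by rw [hh']; assumption⟩, ⟨⟨_, rfl⟩, _, rfl⟩, ?_, ?_, ?_, ?_⟩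
    · simp only [Slot.rect]
      exact_mod_cast sub_pos.2 h2
    · rw [hp]
      simp only [Slot.rect]
      exact_mod_cast h1
    · rw [hrx, hq]
      exact_mod_cast h3
    · rw [hy]
      exact this.1
    · rw [hy, hh']
      exact this.2
  have hcover : ∀ i : ↥((T : Set Rect) ∪ pseudoItems B T),
      (((i : Rect).moveTo (Ξ i)).inter B).Inside ((σ i).rect B) := by
    intro i
    obtain ⟨-, h0, h1, h2⟩ := hcov i
    obtain ⟨hy, hh'⟩ := hrect i _ h0
    have h1 : ((σ i).left : ℝ) ≤ max (ξ i : ℝ) p := by exact_mod_cast h1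
    have h2 : min ((ξ i : ℝ) + D.w i) q ≤ (σ i).right := by exact_mod_cast h2
    refine ⟨?_, ?_, ?_, ?_⟩
    · rw [hlx]
      simpa only [Rect.inter, Rect.moveTo, hΞ, hp] using h1
    · rw [hrx]
      simp only [Rect.inter, Rect.moveTo, hΞ, add_sub_cancel]
      rw [hw, hq]
      exact h2
    · rw [hy]
      exact le_max_left _ _
    · rw [hy, hh']
      simp [Rect.inter, Rect.moveTo]
  refine ⟨Ξ, G, ⟨?_, ?_, ?_, ?_⟩, hpos, hslots, ?_, ?_, ?_⟩
  · intro r hr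
    exact ⟨_, hΞ ⟨r, hr⟩⟩
  · intro t ht hc
    have := hout ⟨t, Or.inl ht⟩ (fun h => (hinner ⟨t, Or.inl ht⟩).2 h hc)
    rw [hΞ ⟨t, Or.inl ht⟩, this, ← hl]
  · intro r hr hc
    have h1 := hin ⟨r, hr⟩ ((hinner ⟨r, hr⟩).1 hc)
    refine ⟨?_, ?_, (hB.item_within hr).1, (hB.item_within hr).2⟩
    · rw [hp]
      simp only [Rect.moveTo, hΞ ⟨r, hr⟩]
      exact_mod_cast h1.1
    · rw [hq]
      have e : r.w = D.w ⟨r, hr⟩ := hw ⟨r, hr⟩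
      simp only [Rect.moveTo, hΞ ⟨r, hr⟩, e]
      exact_mod_cast h1.2
  · intro r hr s hs hrs ⟨h1, h2, h3, h4⟩
    have e : r.w = D.w ⟨r, hr⟩ := hw ⟨r, hr⟩
    have e' : s.w = D.w ⟨s, hs⟩ := hw ⟨s, hs⟩
    simp only [Rect.moveTo, hΞ ⟨r, hr⟩, hΞ ⟨s, hs⟩, e, e'] at h1 h2 h3 h4
    have h1 : ξ ⟨r, hr⟩ < ξ ⟨s, hs⟩ + D.w ⟨s, hs⟩ := by exact_mod_cast h1
    have h2 : ξ ⟨s, hs⟩ < ξ ⟨r, hr⟩ + D.w ⟨r, hr⟩ := by exact_mod_cast h2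
    have a1 := TwoRows.w_pos (D := D) ⟨r, hr⟩
    have a2 := TwoRows.w_pos (D := D) ⟨s, hs⟩
    have := hclash ⟨r, hr⟩ ⟨s, hs⟩ h3 h4 (max (ξ ⟨r, hr⟩) (ξ ⟨s, hs⟩) + 1)
      (by omega) (by omega) (by omega) (by omega)
    exact hrs (congrArg Subtype.val this)
  · intro g hg r hr h
    have := hitem g hg ⟨r, hr⟩ h
    refine ⟨?_, (hrect ⟨r, hr⟩ g this).2⟩
    rw [this]
    exact htall ⟨r, hr⟩
  · intro r hr
    obtain ⟨h1, h2, -⟩ := hcov ⟨r, hr⟩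
    refine ⟨σ ⟨r, hr⟩, h1, ?_, (hrect ⟨r, hr⟩ _ h2).2, hcover ⟨r, hr⟩⟩
    rw [h2]
    exact htall ⟨r, hr⟩
  -- A slot contains an item, so if there is one, `S` and `K` are at least 1, which absorbs the
  -- additive constants.
  · rcases G.eq_empty_or_nonempty with he | ⟨g, hg⟩
    · rw [he, Finset.card_empty]
      omega
    · obtain ⟨i, -⟩ := hex g hg g.left le_rfl (hfill g hg).2.1
      have hA : 0 < (Finset.univ.image D.attr).card :=
        Finset.card_pos.2 ⟨_, Finset.mem_image_of_mem _ (Finset.mem_univ i)⟩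
      have hS : 0 < (Finset.univ.image D.h).card :=
        Finset.card_pos.2 ⟨_, Finset.mem_image_of_mem _ (Finset.mem_univ i)⟩
      have hK := card_attr_le D htall hh
      rw [card_heights_eq D hh] at hS hG
      refine hG.trans ?_
      generalize numSizes ((T : Set Rect) ∪ pseudoItems B T) = S at hS ⊢
      generalize numSizes (pseudoItems B T) + numSizes (T : Set Rect) = K at hK ⊢
      generalize (Finset.univ.image D.attr).card = A at hA hK ⊢
      have hK1 : 1 ≤ K := by omega
      -- With `A ≤ 2K`, `S + 1 ≤ 2S` and `2 ≤ 2K`, the product is at most `24KS`, and `3 ≤ 3KS`.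
      calc 2 * ((S + 1) * (2 * A + 2)) + 3
          ≤ 2 * ((S + S) * (2 * (2 * K) + 2 * K)) + 3 * (K * S) := by
            gcongr
            · exact hS
            · omega
            · exact Nat.le_mul_of_pos_right 3 (Nat.mul_pos hK1 hS)
        _ = 27 * K * S := by ring

theorem Rect.Inside.of_inter {r s b : Rect} (h : r.Inside s) (hb : (r.inter s).Inside b) :
    r.Inside b := by
  obtain ⟨h1, h2, h3, h4⟩ := h
  obtain ⟨g1, g2, g3, g4⟩ := hb
  simp only [Rect.inter, max_eq_left h1, min_eq_left h2, max_eq_left h3, min_eq_left h4,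
    add_sub_cancel] at g1 g2 g3 g4
  exact ⟨g1, g2, g3, g4⟩

theorem IsLargeBox.exists_subboxes (hB : IsLargeBox ε OPT B T V) (hε : 0 < ε) (hO : 0 < OPT) :
    ∃ (ξ : Rect → ℝ) (BT BV : Finset Rect), IsReordering B T ξ ∧ IsSubboxPartition B T ξ BT BV ∧
      BT.card + BV.card ≤ 27 * (numSizes (pseudoItems B T) + numSizes (T : Set Rect)) *
        numSizes ((T : Set Rect) ∪ pseudoItems B T) := by
  classical
  obtain ⟨ξ, G, hξ, hpos, hslots, hitem, hcov, hG⟩ := hB.exists_slots hε hO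
  have hmem : ∀ (P : Slot → Prop) [DecidablePred P] (b : Rect), b ∈ (G.filter P).image (Slot.rect B) →
      ∃ g ∈ G, P g ∧ g.rect B = b := by
    intro P _ b hb
    obtain ⟨g, hg, rfl⟩ := Finset.mem_image.1 hb
    rw [Finset.mem_filter] at hg
    exact ⟨g, hg.1, hg.2, rfl⟩
  have hall : ∀ b ∈ (((G.filter fun g => g.attr.2.1 = true).image (Slot.rect B) : Finset Rect) :
      Set Rect) ∪ ((G.filter fun g => ¬ g.attr.2.1 = true).image (Slot.rect B) : Finset Rect),
      ∃ g ∈ G, g.rect B = b := by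
    rintro b (hb | hb)
    · obtain ⟨g, hg, -, h⟩ := hmem _ b hb
      exact ⟨g, hg, h⟩
    · obtain ⟨g, hg, -, h⟩ := hmem _ b hb
      exact ⟨g, hg, h⟩
  refine ⟨ξ, (G.filter fun g => g.attr.2.1 = true).image (Slot.rect B),
    (G.filter fun g => ¬ g.attr.2.1 = true).image (Slot.rect B), hξ,
    ⟨?_, ?_, ?_, ?_, ?_, ?_, ?_, ?_⟩, ?_⟩
  · intro b hb
    obtain ⟨g, hg, rfl⟩ := hall b hb
    exact (hpos g hg).1
  · intro b hb
    obtain ⟨g, hg, rfl⟩ := hall b hb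
    exact (hpos g hg).2.1
  · intro b hb
    obtain ⟨g, hg, rfl⟩ := hall b hb
    exact (hpos g hg).2.2
  · rw [Finset.disjoint_left]
    intro b hb hb'
    obtain ⟨g, hg, h1, rfl⟩ := hmem _ b hb
    obtain ⟨g', hg', h2, h3⟩ := hmem _ _ hb'
    have hP := (hpos g hg).1
    have hw0 := hP.1
    have hh0 := hP.2
    -- A rectangle of both kinds would overlap itself, so its two slots would be equal, although
    -- their kinds differ.
    refine h2 ((hslots g hg g' hg' ?_) ▸ h1)
    rw [h3]
    exact ⟨by linarith, by linarith, by linarith, by linarith⟩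
  · intro b hb b' hb' hbb h
    obtain ⟨g, hg, rfl⟩ := hall b hb
    obtain ⟨g', hg', rfl⟩ := hall b' hb'
    exact hbb (by rw [hslots g hg g' hg' h])
  · intro t ht
    obtain ⟨g, hg, h1, h2, h3⟩ := hcov t (Or.inl ht)
    exact ⟨g.rect B, Finset.mem_image_of_mem _ (Finset.mem_filter.2 ⟨hg, by simpa [h1] using ht⟩),
      h2, h3⟩
  · intro b hb r hr h
    obtain ⟨g, hg, hgt, rfl⟩ := hmem _ b hb
    obtain ⟨h1, h2⟩ := hitem g hg r hr h
    rw [h1, decide_eq_true_eq] at hgt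
    exact ⟨hgt, h2.symm⟩
  · intro r hr
    obtain ⟨g, hg, h1, h2, h3⟩ := hcov r (Or.inr hr)
    have hrT := hB.pseudo_notMem hr
    -- A moved pseudo item lies in `B`, so clipping it to `B` changes nothing.
    exact ⟨g.rect B, Finset.mem_image_of_mem _ (Finset.mem_filter.2 ⟨hg, by simpa [h1] using hrT⟩),
      (hξ.movable r (Or.inr hr) (hB.pseudo_not_crosses hr)).of_inter h3⟩
  · refine le_trans ?_ hG
    rw [← Finset.card_filter_add_card_filter_not (s := G) fun g => g.attr.2.1 = true]
    exact Nat.add_le_add Finset.card_image_le Finset.card_image_le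

end

end StripPacking

theorem mainTheorem4 :
    ∃ C : ℝ, 0 < C ∧
      ∀ (ε OPT : ℝ), 0 < ε → 0 < OPT →
      ∀ (B : StripPacking.Rect) (T V : Finset StripPacking.Rect),
        StripPacking.IsLargeBox ε OPT B T V →
        ∃ (ξ : StripPacking.Rect → ℝ) (BT BV : Finset StripPacking.Rect),
          StripPacking.IsReordering B T ξ ∧
          StripPacking.IsSubboxPartition B T ξ BT BV ∧
          StripPacking.FractionallyPacks (StripPacking.coveredSlices B T V) BV ∧
          ((BT.card + BV.card : ℕ) : ℝ) ≤
            C * ((StripPacking.numSizes (StripPacking.pseudoItems B T) +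
                  StripPacking.numSizes (T : Set StripPacking.Rect) : ℕ) : ℝ) *
              (StripPacking.numSizes
                ((T : Set StripPacking.Rect) ∪ StripPacking.pseudoItems B T) : ℝ) := by
  refine ⟨27, by norm_num, fun ε OPT hε hO B T V hB => ?_⟩
  obtain ⟨ξ, BT, BV, h1, h2, h3⟩ := hB.exists_subboxes hε hO
  refine ⟨ξ, BT, BV, h1, h2, ?_, by exact_mod_cast h3⟩
  exact StripPacking.fractionallyPacks_of_move ξ hB.vertical_pos
    (fun p hp => hB.pseudo_pos hε hO hp) hB.feasible_vertical
    (h1.feasible.mono Set.subset_union_right) h2.pseudo
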